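/- Let $d\ge 1$ and let $p:\mathbb{Z}^d\to[0,1]$ be the one-step law of an irreducible finite-range random walk on $\mathbb{Z}^d$: $p\ge 0$, $\sum_x p(x)=1$, and the support $\mathcal{V}=\{v: p(v)>0\}$ is finite. Let $p(n;x)$ be its $n$-step transition density, that is $p(0;x)=\mathbf{1}_{\{x=0\}}$ and $p(n+1;x)=\sum_{y\in\mathbb{Z}^d}p(n;y)\,p(x-y)$; irreducible means that for every $x\in\mathbb{Z}^d$ there is $n\ge1$ with $p(n;x)>0$. Let $r=\gcd\{n\ge 1: p(n;0)>0\}$ be the period, and let $X_j=\{x\in\mathbb{Z}^d: p(j+kr;x)>0\text{ for some }k\ge 0\}$ for $j=0,\dots,r-1$ be the aperiodic classes. For $u\in\mathbb{R}^d$ put $\kappa(u)=\sum_{v\in\mathcal{V}}p(v)e^{\langle u,v\rangle}$, let $B_u$ be the quadratic form $B_u(w,w)=D_w^2\log\kappa(u)$ on $\mathbb{R}^d$, where $D_w$ is the derivative along $w$ (so $\det B_u$ is the determinant of the Hessian matrix of $\log\kappa$ at $u$), and let $\mathcal{M}$ be the interior of the convex hull of $\mathcal{V}$ in $\mathbb{R}^d$.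 There are constants $\eta\ge 1$ and $C>0$, depending only on $p$, such that for all $j\in\{0,\dots,r-1\}$, all $n\ge1$ and all $x\in X_j$ the following holds. (i) If $n\equiv j\pmod r$ and $\delta=x/n\in\mathcal{M}$, then there is a unique $s=s(\delta)\in\mathbb{R}^d$ with $\nabla\log\kappa(s)=\delta$, the maximum $$\phi(\delta)=\max\{\langle u,\delta\rangle-\log\kappa(u): u\in\mathbb{R}^d\}$$ is attained, $\det B_s>0$, and $$p(n;x)=(2\pi n)^{-d/2}(\det B_s)^{-1/2}e^{-n\phi(\delta)}\,(r+E),\qquad |E|\le C\,n^{-1}\operatorname{dist}(\delta,\partial\mathcal{M})^{-2\eta},$$ where $\operatorname{dist}$ is the Euclidean distance. (ii) If $n\not\equiv j\pmod r$, then $p(n;x)=0$. -/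

import Mathlib

open scoped BigOperators

noncomputable section

/-- A finite-range (translation invariant) random walk on `ℤ^d`, given by its one-step law
`p x = p(0, x)`; the transition density is `p(x, y) = p (y - x)`. -/
structure FiniteRangeWalk (d : ℕ) where
  /-- the one-step law -/
  p : (Fin d → ℤ) → ℝ
  nonneg : ∀ x, 0 ≤ p x
  finite_support : p.support.Finite
  hasSum_one : HasSum p 1

/-- The inclusion of `ℤ^d` into Euclidean space `ℝ^d`. -/
def latticePoint {d : ℕ} (x : Fin d → ℤ) : EuclideanSpace ℝ (Fin d) :=
  WithLp.toLp 2 (fun i => (x i : ℝ))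

/-- The matrix, in the standard basis, of the bilinear form `(u, w) ↦ D_u (D_w f) (x)`, where
`D_u` is the derivative along `u`; for smooth `f` it is the symmetric bilinear form whose
quadratic form is `u ↦ D_u ^ 2 f (x)`. -/
def hessianMatrix {d : ℕ} (f : EuclideanSpace ℝ (Fin d) → ℝ) (x : EuclideanSpace ℝ (Fin d)) :
    Matrix (Fin d) (Fin d) ℝ :=
  Matrix.of fun i j =>
    lineDeriv ℝ (fun y => lineDeriv ℝ f y (EuclideanSpace.single j (1 : ℝ))) x
      (EuclideanSpace.single i (1 : ℝ))

namespace FiniteRangeWalk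

variable {d : ℕ} (W : FiniteRangeWalk d)

/-- The `n`-step transition density `p(n; x)`: it is the unit mass at `0` for `n = 0`, and
`p(n + 1; x) = ∑_y p(n; y) p(x - y)`; all these sums have finitely many nonzero terms. -/
def step : ℕ → (Fin d → ℤ) → ℝ
  | 0, x => if x = 0 then 1 else 0
  | n + 1, x => ∑' y : Fin d → ℤ, step n y * W.p (x - y)

/-- Irreducibility: every point is reached from `0` with positive probability. -/
def Irreducible : Prop :=
  ∀ x : Fin d → ℤ, ∃ n : ℕ, 1 ≤ n ∧ 0 < W.step n x

/-- The period: the greatest common divisor of the possible return times to `0`. -/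
def period : ℕ := Nat.setGcd {n : ℕ | 1 ≤ n ∧ 0 < W.step n 0}

/-- The class `X_j = {x : p(j + k r; x) > 0 for some k ≥ 0}`, with `r` the period. -/
def aperiodicClass (j : ℕ) : Set (Fin d → ℤ) :=
  {x | ∃ k : ℕ, 0 < W.step (j + k * W.period) x}

/-- The support of the one-step law. -/
def V : Finset (Fin d → ℤ) := W.finite_support.toFinset

/-- The exponential polynomial `κ`, on real arguments. -/
def kappa (x : EuclideanSpace ℝ (Fin d)) : ℝ :=
  ∑ v ∈ W.V, W.p v * Real.exp (inner ℝ x (latticePoint v))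

/-- `log κ`. -/
def logKappa (x : EuclideanSpace ℝ (Fin d)) : ℝ := Real.log (W.kappa x)

/-- The interior `M` of the convex hull of the support in `ℝ^d`. -/
def M : Set (EuclideanSpace ℝ (Fin d)) :=
  interior (convexHull ℝ (latticePoint '' (W.V : Set (Fin d → ℤ))))

/-- The matrix of the quadratic form `B_x (u, u) = D_u ^ 2 log κ (x)`. -/
def B (x : EuclideanSpace ℝ (Fin d)) : Matrix (Fin d) (Fin d) ℝ :=
  hessianMatrix W.logKappa x

/-- The Legendre transform `φ (δ)` of `log κ`, as the supremum of `⟨u, δ⟩ - log κ (u)`. -/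
def phi (δ : EuclideanSpace ℝ (Fin d)) : ℝ :=
  sSup (Set.range fun u : EuclideanSpace ℝ (Fin d) => inner ℝ u δ - W.logKappa u)

end FiniteRangeWalk

end

/-!
After tilting the step distribution by `e^{⟨s, v⟩} / κ(s)`, with `s` chosen so that the tilted mean is
`δ = x / n`, the density `p(n; x)` becomes `e^{-n φ(δ)}` times the density of the tilted walk at its
own mean. What is needed is therefore a local limit theorem for the tilted walks with error
`O(1 / n)`, uniform up to a power of the distance of `δ` to `∂M`.

*Local limit theorem.* For step distributions `q` on a fixed finite family generating `ℤ ^ d`, with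
all weights at least `m`, the characteristic function `ψ` satisfies `|ψ(θ)| ≤ e^{-a |θ|²}` on the
whole cube `[-π, π] ^ d` with `a` proportional to `m`, because
`1 - |ψ|² = ∑ q(v) |e^{i⟨θ, v⟩} - ψ|²`, and `|e^{i⟨θ, x⟩} - 1|` for a basis vector `x` is controlled by
the same quantity at the generators. Write `h` for the centred characteristic function and `b` for
the Gaussian with the same covariance. In `Re (hⁿ) - bⁿ` the first order term involves only
`Re h - b`, of order `|θ|⁴`, so the cubic term never appears, and the second order remainder is of
order `n² |θ|⁶`. Integrating against `e^{-a n |θ|²}` gives a relative error `C m^{-K} / n`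
(`LatticeWalk.exists_abs_integral_re_sub_le`). No separate treatment of small and large frequencies
is required.

*Period.* The times at which a point can be visited define a surjection `ℤ ^ d → ℤ / r` whose kernel
is generated by the differences of steps, so this kernel has index `r`. In a basis of the kernel the
walk is strongly aperiodic; the change of basis multiplies the covariance determinant by `r²`, which
is where the factor `r` comes from (`FiniteRangeWalk.Irreducible.exists_coordinates`).

*Dependence on the boundary.* For each direction `u₀`, only points of `V` off the face exposed by
`u₀` contribute to the distance of the tilted mean from the supporting hyperplane, and for `s` in a
conical neighbourhood of `u₀` their weights are exponentially small in `|s|`. By compactness of the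
sphere, `dist(δ, ∂M) ≤ C e^{-γ |s|}`, so every tilted weight is at least a power of
`dist(δ, ∂M)` (`FiniteRangeWalk.exists_le_tilt`).
-/

/-! ### Elementary estimates and characters of the integer lattice -/

namespace LatticeWalk

/-- Second order Taylor remainder of `z ↦ z ^ n`. Both sides carry a factor `ρ ^ 2` so that no
exponent `n - 2` occurs. -/
theorem norm_pow_sub_pow_sub_mul_le {a b : ℂ} {ρ : ℝ} (ha : ‖a‖ ≤ ρ) (hb : ‖b‖ ≤ ρ)
    (n : ℕ) :
    ‖a ^ n - b ^ n - n * b ^ (n - 1) * (a - b)‖ * ρ ^ 2 ≤ n ^ 2 * ‖a - b‖ ^ 2 * ρ ^ n := by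
  have hρ : 0 ≤ ρ := (norm_nonneg a).trans ha
  induction n with
  | zero => simp
  | succ n ih =>
    have key : a ^ (n + 1) - b ^ (n + 1) - ((n + 1 : ℕ) : ℂ) * b ^ (n + 1 - 1) * (a - b)
        = a * (a ^ n - b ^ n - n * b ^ (n - 1) * (a - b)) + n * b ^ (n - 1) * (a - b) ^ 2 := by
      rcases n with _ | n
      · simp
      · simp only [Nat.add_sub_cancel, Nat.cast_add, Nat.cast_one]
        ring
    rw [key]
    have h1 : ‖a * (a ^ n - b ^ n - n * b ^ (n - 1) * (a - b))‖ * ρ ^ 2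
        ≤ ρ * (n ^ 2 * ‖a - b‖ ^ 2 * ρ ^ n) := by
      rw [norm_mul, mul_assoc]
      exact mul_le_mul ha ih (by positivity) hρ
    have h2 : ‖(n : ℂ) * b ^ (n - 1) * (a - b) ^ 2‖ * ρ ^ 2 ≤ n * ‖a - b‖ ^ 2 * ρ ^ (n + 1) := by
      rcases n with _ | n
      · simp
      · rw [norm_mul, norm_mul, norm_pow, norm_pow, Complex.norm_natCast]
        have : ‖b‖ ^ (n + 1 - 1) ≤ ρ ^ n := by
          simpa using pow_le_pow_left₀ (norm_nonneg b) hb n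
        calc _ ≤ ((n + 1 : ℕ) : ℝ) * ρ ^ n * ‖a - b‖ ^ 2 * ρ ^ 2 := by gcongr
          _ = _ := by ring
    calc _ ≤ (‖a * (a ^ n - b ^ n - n * b ^ (n - 1) * (a - b))‖
          + ‖(n : ℂ) * b ^ (n - 1) * (a - b) ^ 2‖) * ρ ^ 2 := by
            gcongr; exact norm_add_le _ _
      _ ≤ ρ * (n ^ 2 * ‖a - b‖ ^ 2 * ρ ^ n) + n * ‖a - b‖ ^ 2 * ρ ^ (n + 1) := by
          rw [add_mul]; exact add_le_add h1 h2
      _ ≤ _ := by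
          have : 0 ≤ ‖a - b‖ ^ 2 * ρ ^ (n + 1) := by positivity
          push_cast
          rw [show ρ * ((n : ℝ) ^ 2 * ‖a - b‖ ^ 2 * ρ ^ n) + n * ‖a - b‖ ^ 2 * ρ ^ (n + 1)
            = ((n : ℝ) ^ 2 + n) * (‖a - b‖ ^ 2 * ρ ^ (n + 1)) by ring, mul_assoc]
          gcongr
          nlinarith [Nat.cast_nonneg (α := ℝ) n]

theorem abs_cos_sub_le (x : ℝ) : |Real.cos x - (1 - x ^ 2 / 2)| ≤ 3 * x ^ 4 := by
  rcases le_total |x| 1 with h | h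
  · refine (Real.cos_bound h).trans ?_
    have : |x| ^ 4 = x ^ 4 := by rw [← abs_pow]; exact abs_of_nonneg (by positivity)
    rw [this]; nlinarith [show 0 ≤ x ^ 4 by positivity]
  · have h2 : 1 ≤ x ^ 2 := by rw [← sq_abs]; nlinarith
    rw [abs_le]
    constructor <;> nlinarith [Real.neg_one_le_cos x, Real.cos_le_one x]

theorem abs_sin_sub_le (x : ℝ) : |Real.sin x - x| ≤ 2 * |x| ^ 3 := by
  rcases le_total |x| 1 with h | h
  · have h0 := abs_nonneg x
    have h1 := Real.sin_bound h
    have h2 : |Real.sin x - x| ≤ |Real.sin x - (x - x ^ 3 / 6)| + |x ^ 3 / 6| := by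
      have : Real.sin x - x = (Real.sin x - (x - x ^ 3 / 6)) + (- (x ^ 3 / 6)) := by ring
      rw [this]; exact (abs_add_le _ _).trans (by rw [abs_neg])
    have h3 : |x ^ 3 / 6| = |x| ^ 3 / 6 := by rw [abs_div, abs_pow]; norm_num
    rw [h3] at h2
    have h4 : |x| ^ 5 ≤ |x| ^ 3 := pow_le_pow_of_le_one h0 h (by norm_num)
    have h5 : 0 ≤ |x| ^ 3 := by positivity
    linarith
  · have h1 : |Real.sin x - x| ≤ 1 + |x| := (abs_sub _ _).trans (by gcongr; exact Real.abs_sin_le_one x)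
    have : |x| ≤ |x| ^ 3 := by nlinarith [mul_nonneg (abs_nonneg x) (sub_nonneg.2 h), mul_le_mul h h (by norm_num) (abs_nonneg x), sq_nonneg |x|]
    linarith

theorem abs_exp_neg_sub_le {x : ℝ} (hx : 0 ≤ x) : |Real.exp (-x) - (1 - x)| ≤ x ^ 2 := by
  rcases le_total x 1 with h | h
  · have := Real.abs_exp_sub_one_sub_id_le (x := -x) (by rw [abs_neg, abs_of_nonneg hx]; exact h)
    rw [neg_sq] at this
    convert this using 2; ring
  · have h1 : Real.exp (-x) ≤ 1 := Real.exp_le_one_iff.2 (by linarith)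
    have h2 := Real.exp_pos (-x)
    rw [abs_le]; constructor <;> nlinarith

variable {d : ℕ}

/-- The pairing `⟨θ, x⟩ = ∑ i, θ i * x i` of a frequency with a lattice point. -/
noncomputable def pairing (θ : Fin d → ℝ) : (Fin d → ℤ) →+ ℝ where
  toFun x := ∑ i, θ i * x i
  map_zero' := by simp
  map_add' x y := by simp [mul_add, Finset.sum_add_distrib]

theorem pairing_apply (θ : Fin d → ℝ) (x : Fin d → ℤ) : pairing θ x = ∑ i, θ i * x i := rfl

theorem pairing_smul (t : ℝ) (θ : Fin d → ℝ) (x : Fin d → ℤ) :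
    pairing (t • θ) x = t * pairing θ x := by
  simp [pairing_apply, Finset.mul_sum, mul_assoc]

theorem pairing_single (θ : Fin d → ℝ) (i : Fin d) :
    pairing θ (Pi.single i 1) = θ i := by
  rw [pairing_apply, Finset.sum_eq_single i] <;> simp +contextual

theorem continuous_pairing (x : Fin d → ℤ) : Continuous fun θ : Fin d → ℝ => pairing θ x := by
  simp only [pairing_apply]; fun_prop

theorem pairing_sq_le (θ : Fin d → ℝ) (x : Fin d → ℤ) :
    pairing θ x ^ 2 ≤ (∑ i, θ i ^ 2) * ∑ i, (x i : ℝ) ^ 2 := by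
  rw [pairing_apply]
  exact Finset.sum_mul_sq_le_sq_mul_sq _ _ _

/-- The character `θ ↦ exp (i ⟨θ, x⟩)`. -/
noncomputable def character (θ : Fin d → ℝ) (x : Fin d → ℤ) : ℂ := Complex.exp (Complex.I * (pairing θ x : ℝ))

theorem norm_character (θ : Fin d → ℝ) (x : Fin d → ℤ) : ‖character θ x‖ = 1 := by
  rw [character, mul_comm, Complex.norm_exp_ofReal_mul_I]

theorem character_zero (θ : Fin d → ℝ) : character θ 0 = 1 := by simp [character]

theorem character_add (θ : Fin d → ℝ) (x y : Fin d → ℤ) :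
    character θ (x + y) = character θ x * character θ y := by
  simp [character, mul_add, Complex.exp_add]

theorem character_neg (θ : Fin d → ℝ) (x : Fin d → ℤ) :
    character θ (-x) * character θ x = 1 := by
  rw [← character_add, neg_add_cancel, character_zero]

theorem continuous_character (x : Fin d → ℤ) :
    Continuous fun θ : Fin d → ℝ => character θ x := by
  unfold character
  have := continuous_pairing x
  fun_prop

theorem norm_character_sub_one_le (θ : Fin d → ℝ) (x : Fin d → ℤ) :
    ‖character θ x - 1‖ ≤ |pairing θ x| := by
  simpa [character] using Real.norm_exp_I_mul_ofReal_sub_one_le (x := pairing θ x)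

section Generating

variable {ι : Type*} [Fintype ι] {c : ι → Fin d → ℤ}

/-- The set of lattice points at which `|e^{i⟨θ, x⟩} - 1|` is controlled by its values at the
points `c v` is a subgroup; it is everything as soon as the `c v` generate. -/
theorem exists_norm_character_sub_one_le (hc : AddSubgroup.closure (Set.range c) = ⊤)
    (x : Fin d → ℤ) :
    ∃ K : ℝ, 0 ≤ K ∧ ∀ θ : Fin d → ℝ,
      ‖character θ x - 1‖ ≤ K * ∑ v, ‖character θ (c v) - 1‖ := by
  have hx : x ∈ AddSubgroup.closure (Set.range c) := hc ▸ AddSubgroup.mem_top x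
  induction hx using AddSubgroup.closure_induction with
  | mem x hx =>
    obtain ⟨v, rfl⟩ := hx
    refine ⟨1, zero_le_one, fun θ => ?_⟩
    rw [one_mul]
    exact Finset.single_le_sum (f := fun v => ‖character θ (c v) - 1‖)
      (fun _ _ => norm_nonneg _) (Finset.mem_univ v)
  | zero => exact ⟨0, le_rfl, fun θ => by simp [character_zero]⟩
  | add x y _ _ hx hy =>
    obtain ⟨K, hK, h⟩ := hx
    obtain ⟨K', hK', h'⟩ := hy
    refine ⟨K + K', add_nonneg hK hK', fun θ => ?_⟩
    have : character θ (x + y) - 1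
        = character θ x * (character θ y - 1) + (character θ x - 1) := by
      rw [character_add]; ring
    rw [this, add_mul, add_comm (K * _)]
    refine (norm_add_le _ _).trans (add_le_add ?_ (h θ))
    rw [norm_mul, norm_character, one_mul]
    exact h' θ
  | neg x _ hx =>
    obtain ⟨K, hK, h⟩ := hx
    refine ⟨K, hK, fun θ => ?_⟩
    have : character θ (-x) - 1 = - (character θ (-x) * (character θ x - 1)) := by
      rw [mul_sub, character_neg]; ring
    rw [this, norm_neg, norm_mul, norm_character, one_mul]
    exact h θ

theorem exists_le_sum_norm_character_sub_one_sq
    (hc : AddSubgroup.closure (Set.range c) = ⊤) :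
    ∃ κ : ℝ, 0 < κ ∧ ∀ θ : Fin d → ℝ, (∀ i, |θ i| ≤ Real.pi) →
      κ * ∑ i, θ i ^ 2 ≤ ∑ v, ‖character θ (c v) - 1‖ ^ 2 := by
  choose K hK h using fun i : Fin d => exists_norm_character_sub_one_le hc (Pi.single i 1)
  set T : ℝ := (Fintype.card ι : ℝ) * ∑ i, K i ^ 2 with hT
  have hT0 : 0 ≤ T := by positivity
  refine ⟨(2 / Real.pi) ^ 2 / (T + 1), by positivity, fun θ hθ => ?_⟩
  have hi : ∀ i, (2 / Real.pi) ^ 2 * θ i ^ 2 ≤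
      K i ^ 2 * (Fintype.card ι * ∑ v, ‖character θ (c v) - 1‖ ^ 2) := by
    intro i
    have h1 : 2 / Real.pi * |θ i| ≤ ‖character θ (Pi.single i 1) - 1‖ := by
      rw [character, pairing_single, Complex.norm_exp_I_mul_ofReal_sub_one, norm_mul,
        Real.norm_eq_abs, Real.norm_eq_abs]
      have := Real.mul_abs_le_abs_sin (x := θ i / 2) (by
        rw [abs_div, abs_two]; linarith [hθ i])
      rw [abs_div, abs_two] at this
      rw [abs_two]
      linarith
    have h2 := h1.trans (h i θ)
    have h3 := pow_le_pow_left₀ (by positivity) h2 2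
    rw [mul_pow, mul_pow, sq_abs] at h3
    refine h3.trans ?_
    gcongr
    have := sq_sum_le_card_mul_sum_sq (s := Finset.univ)
      (f := fun v => ‖character θ (c v) - 1‖)
    simpa using this
  have hs := Finset.sum_le_sum fun i (_ : i ∈ Finset.univ) => hi i
  rw [← Finset.mul_sum, ← Finset.sum_mul] at hs
  rw [div_mul_eq_mul_div, div_le_iff₀ (by positivity)]
  refine hs.trans ?_
  have hn : 0 ≤ ∑ v, ‖character θ (c v) - 1‖ ^ 2 := by positivity
  calc _ = (∑ v, ‖character θ (c v) - 1‖ ^ 2) * T := by rw [hT]; ring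
    _ ≤ _ := by gcongr; linarith

/-- The lower bound is scaled down to the origin, where `|e^{it} - 1| ≤ |t|`. -/
theorem le_sum_pairing_sq {κ : ℝ}
    (hκ : ∀ θ : Fin d → ℝ, (∀ i, |θ i| ≤ Real.pi) →
      κ * ∑ i, θ i ^ 2 ≤ ∑ v, ‖character θ (c v) - 1‖ ^ 2) (θ : Fin d → ℝ) :
    κ * ∑ i, θ i ^ 2 ≤ ∑ v, pairing θ (c v) ^ 2 := by
  set ε : ℝ := Real.pi / (1 + ‖θ‖) with hε
  have hε0 : 0 < ε := by positivity
  have h := hκ (ε • θ) fun i => by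
    have : |θ i| ≤ 1 + ‖θ‖ := by
      have := norm_le_pi_norm θ i
      rw [Real.norm_eq_abs] at this; linarith
    rw [Pi.smul_apply, smul_eq_mul, abs_mul, abs_of_pos hε0, hε, div_mul_eq_mul_div,
      div_le_iff₀ (by positivity)]
    gcongr
  have h2 : ∑ v, ‖character (ε • θ) (c v) - 1‖ ^ 2 ≤ ε ^ 2 * ∑ v, pairing θ (c v) ^ 2 := by
    rw [Finset.mul_sum]
    refine Finset.sum_le_sum fun v _ => ?_
    rw [← mul_pow, ← pairing_smul, ← sq_abs (pairing _ _)]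
    gcongr
    exact norm_character_sub_one_le _ _
  have h3 := h.trans h2
  simp only [Pi.smul_apply, smul_eq_mul, mul_pow] at h3
  rw [← Finset.mul_sum, mul_left_comm] at h3
  exact le_of_mul_le_mul_left h3 (by positivity)

end Generating

section WeightedMean

variable {ι : Type*} [Fintype ι]

/-- The variance is the second moment minus the squared norm of the mean. -/
theorem sum_mul_norm_sub_sq {E : Type*} [NormedAddCommGroup E] [InnerProductSpace ℝ E]
    (q : ι → ℝ) (hq : ∑ v, q v = 1) (e : ι → E) :
    ∑ v, q v * ‖e v - ∑ w, q w • e w‖ ^ 2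
      = ∑ v, q v * ‖e v‖ ^ 2 - ‖∑ w, q w • e w‖ ^ 2 := by
  set ψ := ∑ w, q w • e w with hψ
  have h : ∑ v, q v * inner ℝ (e v) ψ = ‖ψ‖ ^ 2 := by
    rw [← real_inner_self_eq_norm_sq]
    conv_rhs => rw [hψ, sum_inner]
    simp [real_inner_smul_left, ← hψ]
  calc _ = ∑ v, (q v * ‖e v‖ ^ 2 - 2 * (q v * inner ℝ (e v) ψ) + q v * ‖ψ‖ ^ 2) := by
        refine Finset.sum_congr rfl fun v _ => ?_
        rw [norm_sub_sq_real]; ring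
    _ = _ := by
        rw [Finset.sum_add_distrib, Finset.sum_sub_distrib, ← Finset.mul_sum, ← Finset.sum_mul,
          h, hq]; ring

/-- The variance of `e` under weights bounded below controls all deviations from one value. -/
theorem mul_sum_norm_sub_sq_le {E : Type*} [NormedAddCommGroup E] [InnerProductSpace ℝ E]
    {q : ι → ℝ} {m : ℝ} (hm : 0 < m) (hmq : ∀ v, m ≤ q v) (hq : ∑ v, q v = 1) (e : ι → E)
    (v₀ : ι) :
    m / (2 * (1 + Fintype.card ι)) * ∑ v, ‖e v - e v₀‖ ^ 2
      ≤ ∑ v, q v * ‖e v‖ ^ 2 - ‖∑ w, q w • e w‖ ^ 2 := by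
  rw [← sum_mul_norm_sub_sq q hq]
  set ψ := ∑ w, q w • e w
  have h1 : ∑ v, ‖e v - e v₀‖ ^ 2 ≤ 2 * (1 + Fintype.card ι) * ∑ v, ‖e v - ψ‖ ^ 2 := by
    have : ∀ v, ‖e v - e v₀‖ ^ 2 ≤ 2 * ‖e v - ψ‖ ^ 2 + 2 * ‖e v₀ - ψ‖ ^ 2 := by
      intro v
      have h := norm_sub_le (e v - ψ) (e v₀ - ψ)
      rw [sub_sub_sub_cancel_right] at h
      nlinarith [sq_nonneg (‖e v - ψ‖ - ‖e v₀ - ψ‖), norm_nonneg (e v - e v₀)]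
    refine (Finset.sum_le_sum fun v _ => this v).trans ?_
    have h0 : ‖e v₀ - ψ‖ ^ 2 ≤ ∑ v, ‖e v - ψ‖ ^ 2 :=
      Finset.single_le_sum (f := fun v => ‖e v - ψ‖ ^ 2)
        (fun _ _ => by positivity) (Finset.mem_univ v₀)
    rw [Finset.sum_add_distrib, ← Finset.mul_sum, Finset.sum_const, nsmul_eq_mul,
      Finset.card_univ]
    nlinarith [mul_le_mul_of_nonneg_left h0 (Nat.cast_nonneg (α := ℝ) (Fintype.card ι))]
  calc _ ≤ m / (2 * (1 + Fintype.card ι)) *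
        (2 * (1 + Fintype.card ι) * ∑ v, ‖e v - ψ‖ ^ 2) := by gcongr
    _ = ∑ v, m * ‖e v - ψ‖ ^ 2 := by rw [← Finset.mul_sum]; field_simp
    _ ≤ _ := Finset.sum_le_sum fun v _ => by gcongr; exact hmq v

end WeightedMean

end LatticeWalk

/-! ### Gaussian integrals and comparison of powers -/

namespace LatticeWalk

open MeasureTheory

variable {d : ℕ}

theorem integrable_exp_neg_mul_sum_sq {t : ℝ} (ht : 0 < t) :
    Integrable fun θ : Fin d → ℝ => Real.exp (-t * ∑ i, θ i ^ 2) := by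
  simp_rw [Finset.mul_sum, Real.exp_sum]
  exact Integrable.fintype_prod (f := fun (_ : Fin d) (x : ℝ) => Real.exp (-t * x ^ 2))
    fun _ => integrable_exp_neg_mul_sq ht

theorem integral_exp_neg_mul_sum_sq {t : ℝ} (ht : 0 < t) :
    ∫ θ : Fin d → ℝ, Real.exp (-t * ∑ i, θ i ^ 2) = (Real.pi / t) ^ ((d : ℝ) / 2) := by
  simp_rw [Finset.mul_sum, Real.exp_sum]
  rw [integral_fintype_prod_volume_eq_pow (fun x : ℝ => Real.exp (-t * x ^ 2)),
    integral_gaussian, Fintype.card_fin, Real.sqrt_eq_rpow, ← Real.rpow_natCast,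
    ← Real.rpow_mul (by positivity)]
  congr 1; ring

open scoped MatrixOrder in
theorem _root_.Matrix.PosDef.exists_transpose_mul_self {S : Matrix (Fin d) (Fin d) ℝ}
    (hS : S.PosDef) : ∃ A : Matrix (Fin d) (Fin d) ℝ, A.transpose * A = S := by
  obtain ⟨A, hA⟩ := CStarAlgebra.nonneg_iff_eq_star_mul_self.mp hS.posSemidef.nonneg
  exact ⟨A, by rw [hA, Matrix.star_eq_conjTranspose, Matrix.conjTranspose_eq_transpose_of_trivial]⟩

theorem integral_exp_neg_mul_dotProduct_mulVec {S : Matrix (Fin d) (Fin d) ℝ} (hS : S.PosDef)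
    {t : ℝ} (ht : 0 < t) :
    ∫ θ : Fin d → ℝ, Real.exp (-t * (θ ⬝ᵥ S.mulVec θ))
      = (Real.pi / t) ^ ((d : ℝ) / 2) * S.det ^ (-(1 : ℝ) / 2) := by
  obtain ⟨A, hA⟩ := hS.exists_transpose_mul_self
  have hdet : S.det = A.det ^ 2 := by rw [← hA, Matrix.det_mul, Matrix.det_transpose, sq]
  have hA0 : A.det ≠ 0 := fun h => by
    have := hS.det_pos; rw [hdet, h] at this; simp at this
  have hform : ∀ θ : Fin d → ℝ, θ ⬝ᵥ S.mulVec θ = ∑ i, (Matrix.toLin' A θ) i ^ 2 := by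
    intro θ
    rw [← hA, ← Matrix.mulVec_mulVec, Matrix.dotProduct_mulVec, Matrix.vecMul_transpose,
      Matrix.toLin'_apply]
    simp [dotProduct, sq]
  have hmeas : Measurable (Matrix.toLin' A) :=
    (Matrix.toLin' A).continuous_of_finiteDimensional.measurable
  have hcont : Continuous fun θ : Fin d → ℝ => Real.exp (-t * ∑ i, θ i ^ 2) := by fun_prop
  simp_rw [hform]
  have hmap := Real.map_matrix_volume_pi_eq_smul_volume_pi hA0
  rw [← integral_map (φ := Matrix.toLin' A) hmeas.aemeasurable
    (f := fun θ : Fin d → ℝ => Real.exp (-t * ∑ i, θ i ^ 2))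
    hcont.aestronglyMeasurable, hmap, integral_smul_measure, integral_exp_neg_mul_sum_sq ht,
    ENNReal.toReal_ofReal (abs_nonneg _), smul_eq_mul, mul_comm, abs_inv, hdet, ← sq_abs,
    ← Real.rpow_natCast |A.det| 2, ← Real.rpow_mul (abs_nonneg _)]
  norm_num [Real.rpow_neg_one]

/-- The second order comparison of `Re (h ^ n)` with `b ^ n`: the first order term only sees the
real part of `h - b`, which is of fourth order in the frequency, and the remainder is quadratic in
`h - b`, hence of sixth order. -/
theorem abs_re_pow_sub_pow_le {h : ℂ} {b a Q α β Qmax : ℝ} (n : ℕ) (hn : 1 ≤ n)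
    (ha0 : 0 < a) (ha1 : a ≤ 1) (hQ0 : 0 ≤ Q) (hQ : Q ≤ Qmax) (hα : 0 ≤ α) (hβ : 0 ≤ β)
    (hh : ‖h‖ ≤ Real.exp (-(a * Q))) (hb0 : 0 ≤ b) (hb : b ≤ Real.exp (-(a * Q)))
    (hre : |h.re - b| ≤ α * Q ^ 2) (him : h.im ^ 2 ≤ β * Q ^ 3) :
    |(h ^ n).re - b ^ n| ≤
      Real.exp (2 * Qmax) * (48 * (α ^ 2 * Qmax + β) + 8 * α) * ((n : ℝ)⁻¹ * a⁻¹ ^ 3)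
        * Real.exp (-(a * n / 2) * Q) := by
  set ρ := Real.exp (-(a * Q)) with hρ
  have hρ0 : 0 < ρ := Real.exp_pos _
  set γ := α ^ 2 * Qmax + β with hγ
  have hn0 : (0 : ℝ) < n := by exact_mod_cast hn
  have hQm : 0 ≤ Qmax := hQ0.trans hQ
  have hγ0 : 0 ≤ γ := by positivity
  set M := Real.exp (2 * Qmax) with hM
  have haQ : a * Q ≤ Qmax := by nlinarith
  have hM1 : 1 ≤ M * ρ := by
    rw [hM, hρ, ← Real.exp_add]; exact Real.one_le_exp (by nlinarith)
  have hM2 : 1 ≤ M * ρ ^ 2 := by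
    rw [hM, hρ, ← Real.exp_nat_mul, ← Real.exp_add]; exact Real.one_le_exp (by push_cast; nlinarith)
  have hnorm : ‖h - b‖ ^ 2 ≤ γ * Q ^ 3 := by
    rw [Complex.sq_norm, Complex.normSq_apply]
    simp only [Complex.sub_re, Complex.ofReal_re, Complex.sub_im, Complex.ofReal_im, sub_zero]
    have h1 : (h.re - b) * (h.re - b) ≤ (α * Q ^ 2) ^ 2 := by
      rw [← sq, ← sq_abs]; gcongr
    have h2 : (α * Q ^ 2) ^ 2 ≤ α ^ 2 * Qmax * Q ^ 3 := by
      have : (α * Q ^ 2) ^ 2 = α ^ 2 * Q ^ 3 * Q := by ring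
      rw [this, mul_right_comm]; gcongr
    rw [hγ, add_mul]; nlinarith
  -- `b` is real, so the real part of the first order term is `n b ^ (n - 1) (Re h - b)`.
  have hmain := norm_pow_sub_pow_sub_mul_le (a := h) (b := (b : ℂ)) (ρ := ρ) hh
    (by rwa [Complex.norm_real, Real.norm_eq_abs, abs_of_nonneg hb0]) n
  have hre2 : (h ^ n - (b : ℂ) ^ n - n * (b : ℂ) ^ (n - 1) * (h - b)).re
      = ((h ^ n).re - b ^ n) - n * b ^ (n - 1) * (h.re - b) := by
    rw [← Complex.ofReal_natCast, ← Complex.ofReal_pow, ← Complex.ofReal_pow,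
      ← Complex.ofReal_mul, Complex.sub_re, Complex.sub_re, Complex.re_ofReal_mul,
      Complex.sub_re, Complex.ofReal_re, Complex.ofReal_re]
  have h1 : |((h ^ n).re - b ^ n) - n * b ^ (n - 1) * (h.re - b)|
      ≤ M * (n ^ 2 * (γ * Q ^ 3) * ρ ^ n) := by
    rw [← hre2]
    refine (Complex.abs_re_le_norm _).trans ?_
    have h3 : (n : ℝ) ^ 2 * ‖h - b‖ ^ 2 * ρ ^ n ≤ n ^ 2 * (γ * Q ^ 3) * ρ ^ n := by gcongr
    calc _ ≤ ‖h ^ n - (b : ℂ) ^ n - n * (b : ℂ) ^ (n - 1) * (h - b)‖ * (M * ρ ^ 2) :=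
          le_mul_of_one_le_right (norm_nonneg _) hM2
      _ = M * (‖h ^ n - (b : ℂ) ^ n - n * (b : ℂ) ^ (n - 1) * (h - b)‖ * ρ ^ 2) := by ring
      _ ≤ _ := mul_le_mul_of_nonneg_left (hmain.trans h3) (Real.exp_pos _).le
  have h2 : |n * b ^ (n - 1) * (h.re - b)| ≤ M * (n * ρ ^ n * (α * Q ^ 2)) := by
    rw [abs_mul, abs_of_nonneg (by positivity : 0 ≤ n * b ^ (n - 1))]
    have h3 : b ^ (n - 1) ≤ M * ρ ^ n := by
      calc b ^ (n - 1) ≤ ρ ^ (n - 1) := pow_le_pow_left₀ hb0 hb _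
        _ ≤ ρ ^ (n - 1) * (M * ρ) := le_mul_of_one_le_right (by positivity) hM1
        _ = M * (ρ ^ (n - 1) * ρ) := by ring
        _ = _ := by rw [← pow_succ, Nat.sub_add_cancel hn]
    calc _ ≤ n * (M * ρ ^ n) * (α * Q ^ 2) := by gcongr
      _ = _ := by ring
  have hρn : ρ ^ n = Real.exp (-(a * n / 2) * Q) * Real.exp (-(a * n * Q / 2)) := by
    rw [hρ, ← Real.exp_nat_mul, ← Real.exp_add]; congr 1; ring
  -- Half of the exponential decay absorbs the powers of `n Q`; one factor `1 / n` is left over.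
  set T := a * n * Q / 2 with hT
  have hT0 : 0 ≤ T := by positivity
  have hk : ∀ k : ℕ, T ^ k * Real.exp (-T) ≤ k.factorial := by
    intro k
    have := Real.pow_div_factorial_le_exp T hT0 k
    rw [div_le_iff₀ (by positivity)] at this
    rw [Real.exp_neg, mul_inv_le_iff₀ (Real.exp_pos _), mul_comm]
    exact this
  have ha1' : 1 ≤ a⁻¹ := (one_le_inv₀ ha0).2 ha1
  have e3 : (n : ℝ) ^ 2 * Q ^ 3 * Real.exp (-T) ≤ 48 * ((n : ℝ)⁻¹ * a⁻¹ ^ 3) := by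
    have := hk 3
    have e : (n : ℝ) ^ 2 * Q ^ 3 = 8 * ((n : ℝ)⁻¹ * a⁻¹ ^ 3) * T ^ 3 := by
      rw [hT]; field_simp; norm_num
    rw [e, mul_assoc]
    calc _ ≤ 8 * ((n : ℝ)⁻¹ * a⁻¹ ^ 3) * ((3 : ℕ).factorial : ℝ) := by gcongr
      _ = _ := by norm_num [Nat.factorial]; ring
  have e2 : (n : ℝ) * Q ^ 2 * Real.exp (-T) ≤ 8 * ((n : ℝ)⁻¹ * a⁻¹ ^ 3) := by
    have := hk 2
    have e : (n : ℝ) * Q ^ 2 = 4 * ((n : ℝ)⁻¹ * a⁻¹ ^ 2) * T ^ 2 := by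
      rw [hT]; field_simp; norm_num
    rw [e, mul_assoc]
    calc _ ≤ 4 * ((n : ℝ)⁻¹ * a⁻¹ ^ 2) * ((2 : ℕ).factorial : ℝ) := by gcongr
      _ = 8 * ((n : ℝ)⁻¹ * a⁻¹ ^ 2) := by norm_num [Nat.factorial]; ring
      _ ≤ _ := by gcongr; norm_num
  have h3 : |(h ^ n).re - b ^ n| ≤
      M * (n ^ 2 * (γ * Q ^ 3) * ρ ^ n) + M * (n * ρ ^ n * (α * Q ^ 2)) := by
    have := abs_add_le (((h ^ n).re - b ^ n) - n * b ^ (n - 1) * (h.re - b))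
      (n * b ^ (n - 1) * (h.re - b))
    rw [sub_add_cancel] at this
    linarith
  refine h3.trans ?_
  rw [hρn]
  set X := Real.exp (-(a * n / 2) * Q)
  calc _ = M * (γ * ((n : ℝ) ^ 2 * Q ^ 3 * Real.exp (-T)) + α * ((n : ℝ) * Q ^ 2 * Real.exp (-T))) * X := by
        ring
    _ ≤ M * (γ * (48 * ((n : ℝ)⁻¹ * a⁻¹ ^ 3)) + α * (8 * ((n : ℝ)⁻¹ * a⁻¹ ^ 3))) * X := by gcongr
    _ = _ := by ring

end LatticeWalk

/-! ### Local limit theorem in Fourier form -/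

namespace LatticeWalk

open MeasureTheory

variable {d : ℕ} {ι : Type*} [Fintype ι]

/-- The characteristic function `θ ↦ ∑ v, q v e^{i⟨θ, c v⟩}` of the distribution giving weight
`q v` to `c v`. -/
noncomputable def charSum (q : ι → ℝ) (c : ι → Fin d → ℤ) (θ : Fin d → ℝ) : ℂ :=
  ∑ v, q v • character θ (c v)

/-- The covariance matrix of the distribution giving weight `q v` to the lattice point `c v`. -/
noncomputable def covMatrix (q : ι → ℝ) (c : ι → Fin d → ℤ) : Matrix (Fin d) (Fin d) ℝ :=
  Matrix.of fun i j => ∑ v, q v * ((c v i : ℝ) * c v j)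
    - (∑ v, q v * (c v i : ℝ)) * ∑ v, q v * (c v j : ℝ)

theorem continuous_charSum (q : ι → ℝ) (c : ι → Fin d → ℤ) : Continuous (charSum q c) := by
  unfold charSum
  exact continuous_finsetSum _ fun v _ => (continuous_character (c v)).const_smul (q v)

theorem sum_mul_pairing (q : ι → ℝ) (c : ι → Fin d → ℤ) (θ : Fin d → ℝ) :
    ∑ v, q v * pairing θ (c v) = ∑ i, θ i * ∑ v, q v * (c v i : ℝ) := by
  simp only [pairing_apply, Finset.mul_sum]
  rw [Finset.sum_comm]
  exact Finset.sum_congr rfl fun i _ => Finset.sum_congr rfl fun v _ => by ring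

theorem dotProduct_covMatrix_mulVec (q : ι → ℝ) (c : ι → Fin d → ℤ) (θ : Fin d → ℝ) :
    θ ⬝ᵥ (covMatrix q c).mulVec θ
      = ∑ v, q v * pairing θ (c v) ^ 2 - (∑ v, q v * pairing θ (c v)) ^ 2 := by
  have h1 : ∑ v, q v * pairing θ (c v) ^ 2
      = ∑ i, ∑ j, θ i * (∑ v, q v * ((c v i : ℝ) * c v j)) * θ j := by
    simp only [pairing_apply, sq, Finset.mul_sum, Finset.sum_mul]
    rw [Finset.sum_comm]
    refine Finset.sum_congr rfl fun i _ => ?_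
    rw [Finset.sum_comm]
    exact Finset.sum_congr rfl fun j _ => Finset.sum_congr rfl fun v _ => by ring
  rw [h1, sum_mul_pairing, sq, Finset.sum_mul_sum, ← Finset.sum_sub_distrib]
  simp only [dotProduct, Matrix.mulVec, covMatrix, Matrix.of_apply, Finset.mul_sum]
  refine Finset.sum_congr rfl fun i _ => ?_
  rw [← Finset.sum_sub_distrib]
  refine Finset.sum_congr rfl fun j _ => ?_
  simp only [← Finset.mul_sum]
  ring

theorem isHermitian_covMatrix (q : ι → ℝ) (c : ι → Fin d → ℤ) : (covMatrix q c).IsHermitian := by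
  ext i j
  simp only [covMatrix, Matrix.conjTranspose_apply, Matrix.of_apply, star_trivial]
  rw [mul_comm (∑ v, q v * (c v j : ℝ))]
  simp only [mul_comm (c _ j : ℝ)]

section Bounds

variable {q : ι → ℝ} {c : ι → Fin d → ℤ} {m κ : ℝ} {v₀ : ι}

theorem norm_charSum_le_exp (hm : 0 < m) (hmq : ∀ v, m ≤ q v) (hq : ∑ v, q v = 1)
    (hc₀ : c v₀ = 0)
    (hκ : ∀ θ : Fin d → ℝ, (∀ i, |θ i| ≤ Real.pi) →
      κ * ∑ i, θ i ^ 2 ≤ ∑ v, ‖character θ (c v) - 1‖ ^ 2)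
    {a : ℝ} (ha : 2 * a ≤ m / (2 * (1 + Fintype.card ι)) * κ)
    {θ : Fin d → ℝ} (hθ : ∀ i, |θ i| ≤ Real.pi) :
    ‖charSum q c θ‖ ≤ Real.exp (-(a * ∑ i, θ i ^ 2)) := by
  have h1 := mul_sum_norm_sub_sq_le hm hmq hq (fun v => character θ (c v)) v₀
  simp only [norm_character, hc₀, character_zero, one_pow, mul_one, hq] at h1
  have h2 : 2 * a * ∑ i, θ i ^ 2
      ≤ m / (2 * (1 + Fintype.card ι)) * ∑ v, ‖character θ (c v) - 1‖ ^ 2 := by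
    calc _ ≤ m / (2 * (1 + Fintype.card ι)) * κ * ∑ i, θ i ^ 2 := by gcongr
      _ = m / (2 * (1 + Fintype.card ι)) * (κ * ∑ i, θ i ^ 2) := by ring
      _ ≤ _ := by gcongr; exact hκ θ hθ
  have h3 := Real.add_one_le_exp (-(2 * a * ∑ i, θ i ^ 2))
  refine le_of_sq_le_sq ?_ (Real.exp_pos _).le
  rw [← Real.exp_nat_mul]
  have h4 : ‖charSum q c θ‖ ^ 2 ≤ 1 - 2 * a * ∑ i, θ i ^ 2 := by
    unfold charSum; linarith
  have h5 : ((2 : ℕ) : ℝ) * -(a * ∑ i, θ i ^ 2) = -(2 * a * ∑ i, θ i ^ 2) := by push_cast; ring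
  rw [h5]; linarith

theorem le_dotProduct_covMatrix_mulVec (hm : 0 < m) (hmq : ∀ v, m ≤ q v) (hq : ∑ v, q v = 1)
    (hc₀ : c v₀ = 0)
    (hκ : ∀ θ : Fin d → ℝ, (∀ i, |θ i| ≤ Real.pi) →
      κ * ∑ i, θ i ^ 2 ≤ ∑ v, ‖character θ (c v) - 1‖ ^ 2)
    {a : ℝ} (ha : 2 * a ≤ m / (2 * (1 + Fintype.card ι)) * κ) (θ : Fin d → ℝ) :
    2 * a * ∑ i, θ i ^ 2 ≤ θ ⬝ᵥ (covMatrix q c).mulVec θ := by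
  have h1 := mul_sum_norm_sub_sq_le hm hmq hq (fun v => pairing θ (c v)) v₀
  simp only [Real.norm_eq_abs, sq_abs, hc₀, map_zero, sub_zero, smul_eq_mul] at h1
  rw [dotProduct_covMatrix_mulVec]
  refine le_trans ?_ h1
  calc _ ≤ m / (2 * (1 + Fintype.card ι)) * κ * ∑ i, θ i ^ 2 := by gcongr
    _ = m / (2 * (1 + Fintype.card ι)) * (κ * ∑ i, θ i ^ 2) := by ring
    _ ≤ _ := by gcongr; exact le_sum_pairing_sq hκ θ

theorem sq_pairing_sub_mean_le (hq0 : ∀ v, 0 ≤ q v) (hq : ∑ v, q v = 1) (θ : Fin d → ℝ) (v : ι) :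
    (pairing θ (c v) - ∑ w, q w * pairing θ (c w)) ^ 2
      ≤ 4 * (∑ w, ∑ i, (c w i : ℝ) ^ 2) * ∑ i, θ i ^ 2 := by
  set L := ∑ w, ∑ i, (c w i : ℝ) ^ 2 with hL
  have hL0 : 0 ≤ L := by positivity
  have h1 : ∀ w, |pairing θ (c w)| ≤ √(L * ∑ i, θ i ^ 2) := by
    intro w
    refine Real.abs_le_sqrt ((pairing_sq_le θ (c w)).trans ?_)
    rw [mul_comm]
    gcongr
    exact Finset.single_le_sum (f := fun w => ∑ i, (c w i : ℝ) ^ 2)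
      (fun _ _ => by positivity) (Finset.mem_univ w)
  have h2 : |∑ w, q w * pairing θ (c w)| ≤ √(L * ∑ i, θ i ^ 2) := by
    calc _ ≤ ∑ w, |q w * pairing θ (c w)| := Finset.abs_sum_le_sum_abs _ _
      _ ≤ ∑ w, q w * √(L * ∑ i, θ i ^ 2) := Finset.sum_le_sum fun w _ => by
          rw [abs_mul, abs_of_nonneg (hq0 w)]
          exact mul_le_mul_of_nonneg_left (h1 w) (hq0 w)
      _ = _ := by rw [← Finset.sum_mul, hq, one_mul]
  have h3 : |pairing θ (c v) - ∑ w, q w * pairing θ (c w)| ≤ 2 * √(L * ∑ i, θ i ^ 2) := by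
    have := abs_sub (pairing θ (c v)) (∑ w, q w * pairing θ (c w))
    linarith [h1 v]
  rw [← sq_abs]
  calc _ ≤ (2 * √(L * ∑ i, θ i ^ 2)) ^ 2 := by gcongr
    _ = _ := by rw [mul_pow, Real.sq_sqrt (by positivity)]; ring

/-- The characteristic function of the centred distribution. -/
noncomputable def centredCharSum (q : ι → ℝ) (c : ι → Fin d → ℤ) (θ : Fin d → ℝ) : ℂ :=
  ∑ v, q v • Complex.exp (((pairing θ (c v) - ∑ w, q w * pairing θ (c w) : ℝ) : ℂ) * Complex.I)

theorem charSum_eq_mul_centredCharSum (q : ι → ℝ) (c : ι → Fin d → ℤ) (θ : Fin d → ℝ) :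
    charSum q c θ = Complex.exp (Complex.I * (∑ w, q w * pairing θ (c w) : ℝ))
      * centredCharSum q c θ := by
  rw [charSum, centredCharSum, Finset.mul_sum]
  refine Finset.sum_congr rfl fun v _ => ?_
  rw [mul_smul_comm, ← Complex.exp_add, character]
  congr 2
  push_cast; ring

theorem norm_centredCharSum (q : ι → ℝ) (c : ι → Fin d → ℤ) (θ : Fin d → ℝ) :
    ‖centredCharSum q c θ‖ = ‖charSum q c θ‖ := by
  rw [charSum_eq_mul_centredCharSum, norm_mul, mul_comm Complex.I, Complex.norm_exp_ofReal_mul_I,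
    one_mul]

/-- At the point `y = n ·` mean, the Fourier integrand is a power of the centred characteristic
function. -/
theorem charSum_pow_mul_character {n : ℕ} {y : Fin d → ℤ}
    (hy : ∀ i, n * ∑ v, q v * (c v i : ℝ) = y i) (θ : Fin d → ℝ) :
    charSum q c θ ^ n * character θ (-y) = centredCharSum q c θ ^ n := by
  have h : pairing θ y = n * ∑ w, q w * pairing θ (c w) := by
    rw [sum_mul_pairing, Finset.mul_sum, pairing_apply]
    exact Finset.sum_congr rfl fun i _ => by rw [← hy i]; ring
  rw [charSum_eq_mul_centredCharSum, mul_pow, ← Complex.exp_nat_mul, mul_right_comm, character,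
    ← Complex.exp_add, map_neg, h]
  have : ((n : ℕ) : ℂ) * (Complex.I * (∑ w, q w * pairing θ (c w) : ℝ))
      + Complex.I * ((-(n * ∑ w, q w * pairing θ (c w)) : ℝ) : ℂ) = 0 := by
    push_cast; ring
  rw [this, Complex.exp_zero, one_mul]

theorem re_centredCharSum (q : ι → ℝ) (c : ι → Fin d → ℤ) (θ : Fin d → ℝ) :
    (centredCharSum q c θ).re
      = ∑ v, q v * Real.cos (pairing θ (c v) - ∑ w, q w * pairing θ (c w)) := by
  simp only [centredCharSum, Complex.re_sum, Complex.smul_re, Complex.exp_ofReal_mul_I_re,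
    smul_eq_mul]

theorem im_centredCharSum (q : ι → ℝ) (c : ι → Fin d → ℤ) (θ : Fin d → ℝ) :
    (centredCharSum q c θ).im
      = ∑ v, q v * Real.sin (pairing θ (c v) - ∑ w, q w * pairing θ (c w)) := by
  simp only [centredCharSum, Complex.im_sum, Complex.smul_im, Complex.exp_ofReal_mul_I_im,
    smul_eq_mul]

theorem sum_mul_sq_pairing_sub_mean (hq : ∑ v, q v = 1) (θ : Fin d → ℝ) :
    ∑ v, q v * (pairing θ (c v) - ∑ w, q w * pairing θ (c w)) ^ 2
      = θ ⬝ᵥ (covMatrix q c).mulVec θ := by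
  rw [dotProduct_covMatrix_mulVec]
  have := sum_mul_norm_sub_sq q hq (fun v => pairing θ (c v))
  simpa [Real.norm_eq_abs, sq_abs] using this

/-- The real part agrees with the Gaussian of the same covariance up to fourth order. -/
theorem abs_re_centredCharSum_sub_exp_le {R Q : ℝ} (hq0 : ∀ v, 0 ≤ q v) (hq : ∑ v, q v = 1)
    {θ : Fin d → ℝ}
    (hx : ∀ v, (pairing θ (c v) - ∑ w, q w * pairing θ (c w)) ^ 2 ≤ R * Q) :
    |(centredCharSum q c θ).re - Real.exp (-(θ ⬝ᵥ (covMatrix q c).mulVec θ) / 2)|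
      ≤ 4 * R ^ 2 * Q ^ 2 := by
  rw [re_centredCharSum, ← sum_mul_sq_pairing_sub_mean hq]
  set x : ι → ℝ := fun v => pairing θ (c v) - ∑ w, q w * pairing θ (c w)
  change |∑ v, q v * Real.cos (x v) - Real.exp (-(∑ v, q v * x v ^ 2) / 2)| ≤ _
  have hx' : ∀ v, x v ^ 2 ≤ R * Q := hx
  set V := ∑ v, q v * x v ^ 2 with hV
  have hV0 : 0 ≤ V := Finset.sum_nonneg fun v _ => mul_nonneg (hq0 v) (sq_nonneg _)
  have hV1 : V ≤ R * Q := by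
    calc V ≤ ∑ v, q v * (R * Q) :=
          Finset.sum_le_sum fun v _ => mul_le_mul_of_nonneg_left (hx' v) (hq0 v)
      _ = _ := by rw [← Finset.sum_mul, hq, one_mul]
  have h1 : |∑ v, q v * Real.cos (x v) - (1 - V / 2)| ≤ 3 * (R * Q) ^ 2 := by
    have e : ∑ v, q v * Real.cos (x v) - (1 - V / 2)
        = ∑ v, q v * (Real.cos (x v) - (1 - x v ^ 2 / 2)) := by
      simp only [mul_sub, Finset.sum_sub_distrib, mul_one, hq, hV, Finset.sum_div]
      simp only [mul_div_assoc]
    rw [e]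
    calc _ ≤ ∑ v, |q v * (Real.cos (x v) - (1 - x v ^ 2 / 2))| := Finset.abs_sum_le_sum_abs _ _
      _ ≤ ∑ v, q v * (3 * (R * Q) ^ 2) := Finset.sum_le_sum fun v _ => by
          rw [abs_mul, abs_of_nonneg (hq0 v)]
          refine mul_le_mul_of_nonneg_left ((abs_cos_sub_le _).trans ?_) (hq0 v)
          have : x v ^ 4 = (x v ^ 2) ^ 2 := by ring
          rw [this]
          gcongr
          exact hx' v
      _ = _ := by rw [← Finset.sum_mul, hq, one_mul]
  have h2 := abs_exp_neg_sub_le (x := V / 2) (by positivity)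
  have h3 : (V / 2) ^ 2 ≤ (R * Q) ^ 2 := by gcongr; linarith
  rw [neg_div]
  have h4 := abs_sub_le (∑ v, q v * Real.cos (x v)) (1 - V / 2) (Real.exp (-(V / 2)))
  rw [abs_sub_comm (1 - V / 2)] at h4
  nlinarith

/-- The imaginary part is of third order, since the linear term vanishes by centring. -/
theorem sq_im_centredCharSum_le {R Q : ℝ} (hq0 : ∀ v, 0 ≤ q v) (hq : ∑ v, q v = 1)
    (hR : 0 ≤ R) (hQ : 0 ≤ Q) {θ : Fin d → ℝ}
    (hx : ∀ v, (pairing θ (c v) - ∑ w, q w * pairing θ (c w)) ^ 2 ≤ R * Q) :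
    (centredCharSum q c θ).im ^ 2 ≤ 4 * R ^ 3 * Q ^ 3 := by
  rw [im_centredCharSum]
  set x : ι → ℝ := fun v => pairing θ (c v) - ∑ w, q w * pairing θ (c w) with hxdef
  change (∑ v, q v * Real.sin (x v)) ^ 2 ≤ _
  have hx' : ∀ v, |x v| ≤ √(R * Q) := fun v => Real.abs_le_sqrt (hx v)
  have hmean : ∑ v, q v * x v = 0 := by
    simp only [hxdef, mul_sub, Finset.sum_sub_distrib]
    rw [← Finset.sum_mul, hq, one_mul, sub_self]
  have e : ∑ v, q v * Real.sin (x v) = ∑ v, q v * (Real.sin (x v) - x v) := by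
    simp only [mul_sub, Finset.sum_sub_distrib, hmean, sub_zero]
  have h : |∑ v, q v * Real.sin (x v)| ≤ 2 * √(R * Q) ^ 3 := by
    rw [e]
    calc _ ≤ ∑ v, |q v * (Real.sin (x v) - x v)| := Finset.abs_sum_le_sum_abs _ _
      _ ≤ ∑ v, q v * (2 * √(R * Q) ^ 3) := Finset.sum_le_sum fun v _ => by
          rw [abs_mul, abs_of_nonneg (hq0 v)]
          refine mul_le_mul_of_nonneg_left ((abs_sin_sub_le _).trans ?_) (hq0 v)
          gcongr
          exact hx' v
      _ = _ := by rw [← Finset.sum_mul, hq, one_mul]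
  rw [← sq_abs]
  calc _ ≤ (2 * √(R * Q) ^ 3) ^ 2 := by gcongr
    _ = 4 * (√(R * Q) ^ 2) ^ 3 := by ring
    _ = _ := by rw [Real.sq_sqrt (by positivity)]; ring

end Bounds

/-- Fourier form of the local limit theorem. The step distribution may be any distribution on the
fixed finite family `c` which generates the lattice, and the error is polynomial in the reciprocal
of the smallest weight `m`. -/
theorem exists_abs_integral_re_sub_le {c : ι → Fin d → ℤ}
    (hc : AddSubgroup.closure (Set.range c) = ⊤) {v₀ : ι} (hc₀ : c v₀ = 0) :
    ∃ C : ℝ, 0 < C ∧ ∀ (q : ι → ℝ) (m : ℝ), 0 < m → (∀ v, m ≤ q v) → ∑ v, q v = 1 →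
      (covMatrix q c).PosDef ∧ ∀ n : ℕ, 1 ≤ n → ∀ y : Fin d → ℤ,
        (∀ i, n * ∑ v, q v * (c v i : ℝ) = y i) →
        |(∫ θ in Set.Icc (fun _ : Fin d => -Real.pi) (fun _ => Real.pi),
            (charSum q c θ ^ n * character θ (-y)).re)
          - (2 * Real.pi / n) ^ ((d : ℝ) / 2) * (covMatrix q c).det ^ (-(1 : ℝ) / 2)|
        ≤ C * ((n : ℝ)⁻¹ * m⁻¹ ^ 3 * ((m * n)⁻¹) ^ ((d : ℝ) / 2)) := by
  obtain ⟨κ, hκ0, hκ⟩ := exists_le_sum_norm_character_sub_one_sq hc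
  set c₀ : ℝ := min 1 (κ / (4 * (1 + Fintype.card ι))) with hc₀def
  have hc₀0 : 0 < c₀ := by positivity
  set R := 4 * (∑ w, ∑ i, (c w i : ℝ) ^ 2) with hR
  have hR0 : 0 ≤ R := by positivity
  set Qm : ℝ := d * Real.pi ^ 2 with hQm
  -- The summand `2` covers the Gaussian tail outside the cube.
  set C₁ := Real.exp (2 * Qm) * (48 * ((4 * R ^ 2) ^ 2 * Qm + 4 * R ^ 3) + 8 * (4 * R ^ 2)) + 2
    with hC₁
  have hC₁2 : 2 ≤ C₁ := by
    have : 0 ≤ Real.exp (2 * Qm) * (48 * ((4 * R ^ 2) ^ 2 * Qm + 4 * R ^ 3) + 8 * (4 * R ^ 2)) := by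
      positivity
    linarith
  refine ⟨C₁ * (c₀⁻¹ ^ 3 * (2 * Real.pi / c₀) ^ ((d : ℝ) / 2)), by positivity,
    fun q m hm hmq hq => ?_⟩
  have hq0 : ∀ v, 0 ≤ q v := fun v => hm.le.trans (hmq v)
  have hm1 : m ≤ 1 := (hmq v₀).trans (by
    rw [← hq]; exact Finset.single_le_sum (fun v _ => hq0 v) (Finset.mem_univ v₀))
  set a := c₀ * m with ha
  have ha0 : 0 < a := by positivity
  have ha1 : a ≤ 1 := by
    have : c₀ ≤ 1 := min_le_left _ _
    nlinarith
  have ha2 : 2 * a ≤ m / (2 * (1 + Fintype.card ι)) * κ := by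
    have : c₀ ≤ κ / (4 * (1 + Fintype.card ι)) := min_le_right _ _
    calc 2 * a ≤ 2 * (κ / (4 * (1 + Fintype.card ι)) * m) := by rw [ha]; gcongr
      _ = _ := by field_simp; norm_num
  have hcov := le_dotProduct_covMatrix_mulVec hm hmq hq hc₀ hκ ha2
  have hpos : (covMatrix q c).PosDef := by
    refine Matrix.PosDef.of_dotProduct_mulVec_pos (isHermitian_covMatrix q c) fun θ hθ => ?_
    rw [star_trivial]
    refine lt_of_lt_of_le ?_ (hcov θ)
    obtain ⟨i, hi⟩ := Function.ne_iff.1 hθ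
    have : 0 < ∑ i, θ i ^ 2 := Finset.sum_pos' (fun _ _ => sq_nonneg _)
      ⟨i, Finset.mem_univ i, sq_pos_of_ne_zero hi⟩
    positivity
  refine ⟨hpos, fun n hn y hy => ?_⟩
  have hn0 : (0 : ℝ) < n := by exact_mod_cast hn
  set K : Set (Fin d → ℝ) := Set.Icc (fun _ : Fin d => -Real.pi) (fun _ => Real.pi) with hK
  have hKmem : ∀ θ, θ ∈ K ↔ ∀ i, |θ i| ≤ Real.pi := by
    intro θ
    simp only [hK, Set.mem_Icc, Pi.le_def, abs_le, ← forall_and]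
  have hKmeas : MeasurableSet K := measurableSet_Icc
  simp only [charSum_pow_mul_character hy]
  set S := covMatrix q c with hS
  have hgauss := integral_exp_neg_mul_dotProduct_mulVec hpos (t := n / 2) (by positivity)
  have hpi : Real.pi / ((n : ℝ) / 2) = 2 * Real.pi / n := by field_simp
  rw [hpi] at hgauss
  rw [← hgauss, ← integral_indicator hKmeas]
  have hcontc : Continuous (centredCharSum q c) := by
    unfold centredCharSum
    have := fun v => continuous_pairing (c v)
    fun_prop
  have hint1 : Integrable (K.indicator fun θ => (centredCharSum q c θ ^ n).re) := by
    rw [integrable_indicator_iff hKmeas]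
    exact (Complex.continuous_re.comp (hcontc.pow n)).continuousOn.integrableOn_compact isCompact_Icc
  have hb : ∀ θ : Fin d → ℝ, Real.exp (-(θ ⬝ᵥ S.mulVec θ) / 2) ≤ Real.exp (-(a * ∑ i, θ i ^ 2)) := by
    intro θ
    rw [Real.exp_le_exp]
    linarith [hcov θ]
  have hbn : ∀ θ : Fin d → ℝ, Real.exp (-((n : ℝ) / 2) * (θ ⬝ᵥ S.mulVec θ))
      = Real.exp (-(θ ⬝ᵥ S.mulVec θ) / 2) ^ n := by
    intro θ
    rw [← Real.exp_nat_mul]; congr 1; ring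
  have hint2 : Integrable fun θ : Fin d → ℝ => Real.exp (-((n : ℝ) / 2) * (θ ⬝ᵥ S.mulVec θ)) := by
    refine (integrable_exp_neg_mul_sum_sq (d := d) (t := a * n) (by positivity)).mono' ?_ ?_
    · have : Continuous fun θ : Fin d → ℝ => Real.exp (-((n : ℝ) / 2) * (θ ⬝ᵥ S.mulVec θ)) := by
        simp only [dotProduct, Matrix.mulVec]; fun_prop
      exact this.aestronglyMeasurable
    · refine Filter.Eventually.of_forall fun θ => ?_
      rw [Real.norm_eq_abs, abs_of_pos (Real.exp_pos _), Real.exp_le_exp]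
      nlinarith [mul_le_mul_of_nonneg_left (hcov θ) hn0.le]
  rw [← integral_sub hint1 hint2]
  have hpt : ∀ θ : Fin d → ℝ, ‖K.indicator (fun θ => (centredCharSum q c θ ^ n).re) θ
      - Real.exp (-((n : ℝ) / 2) * (θ ⬝ᵥ S.mulVec θ))‖
      ≤ C₁ * ((n : ℝ)⁻¹ * a⁻¹ ^ 3) * Real.exp (-(a * n / 2) * ∑ i, θ i ^ 2) := by
    intro θ
    have hQ0 : 0 ≤ ∑ i, θ i ^ 2 := by positivity
    rw [Real.norm_eq_abs, hbn]
    by_cases hθ : θ ∈ K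
    · rw [Set.indicator_of_mem hθ]
      have hθ' := (hKmem θ).1 hθ
      have hQQ : ∑ i, θ i ^ 2 ≤ Qm := by
        calc _ ≤ ∑ _i : Fin d, Real.pi ^ 2 := Finset.sum_le_sum fun i _ => by
              rw [← sq_abs]; gcongr; exact hθ' i
          _ = _ := by simp [hQm]
      have hx := fun v => sq_pairing_sub_mean_le (c := c) hq0 hq θ v
      refine (abs_re_pow_sub_pow_le n hn ha0 ha1 hQ0 hQQ (by positivity) (by positivity)
        ?_ (Real.exp_pos _).le (hb θ) (abs_re_centredCharSum_sub_exp_le hq0 hq hx)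
        (sq_im_centredCharSum_le hq0 hq hR0 hQ0 hx)).trans ?_
      · rw [norm_centredCharSum]
        exact norm_charSum_le_exp hm hmq hq hc₀ hκ ha2 hθ'
      · gcongr
        linarith
    · -- Outside the cube only the Gaussian is left; there `|θ|² ≥ 1`, and `e^{-t} ≤ 1 / t` supplies
      -- the factor `1 / n`.
      rw [Set.indicator_of_notMem hθ, zero_sub, abs_neg, abs_of_pos (by positivity)]
      have hQ1 : 1 ≤ ∑ i, θ i ^ 2 := by
        rw [hKmem] at hθ
        push Not at hθ
        obtain ⟨i, hi⟩ := hθ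
        have h1 : 1 ≤ θ i ^ 2 := by
          rw [← sq_abs]; nlinarith [Real.pi_gt_three]
        exact h1.trans (Finset.single_le_sum (f := fun i => θ i ^ 2)
          (fun _ _ => sq_nonneg _) (Finset.mem_univ i))
      have h1 : Real.exp (-(θ ⬝ᵥ S.mulVec θ) / 2) ^ n ≤ Real.exp (-(a * ∑ i, θ i ^ 2)) ^ n := by
        exact pow_le_pow_left₀ (Real.exp_pos _).le (hb θ) n
      refine h1.trans ?_
      have h2 : Real.exp (-(a * ∑ i, θ i ^ 2)) ^ n
          = Real.exp (-(a * n / 2 * ∑ i, θ i ^ 2)) * Real.exp (-(a * n / 2) * ∑ i, θ i ^ 2) := by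
        rw [← Real.exp_nat_mul, ← Real.exp_add]; congr 1; ring
      rw [h2]
      gcongr
      have h3 : a * n / 2 ≤ a * n / 2 * ∑ i, θ i ^ 2 := le_mul_of_one_le_right (by positivity) hQ1
      have h4 : Real.exp (-(a * n / 2 * ∑ i, θ i ^ 2)) ≤ (a * n / 2)⁻¹ := by
        rw [Real.exp_neg]
        gcongr
        linarith [Real.add_one_le_exp (a * n / 2 * ∑ i, θ i ^ 2)]
      refine h4.trans ?_
      have h5 : 1 ≤ a⁻¹ := (one_le_inv₀ ha0).2 ha1
      calc (a * n / 2)⁻¹ = 2 * ((n : ℝ)⁻¹ * a⁻¹ ^ 1) := by field_simp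
        _ ≤ _ := by gcongr; norm_num
  have hfin := norm_integral_le_of_norm_le
    ((integrable_exp_neg_mul_sum_sq (d := d) (t := a * n / 2) (by positivity)).const_mul
      (C₁ * ((n : ℝ)⁻¹ * a⁻¹ ^ 3))) (Filter.Eventually.of_forall hpt)
  rw [Real.norm_eq_abs, integral_const_mul, integral_exp_neg_mul_sum_sq (by positivity)] at hfin
  refine hfin.trans (le_of_eq ?_)
  have h6 : Real.pi / (a * n / 2) = (2 * Real.pi / c₀) * (m * n)⁻¹ := by rw [ha]; field_simp
  rw [h6, Real.mul_rpow (by positivity) (by positivity), ha, mul_inv, mul_pow]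
  ring

end LatticeWalk

/-! ### The period lattice -/

namespace LatticeWalk

/-- A subgroup of finite index of `ℤ ^ d` is the image of an injective integer matrix whose
determinant is the index up to sign. -/
theorem exists_matrix_of_index_ne_zero {d : ℕ} (Λ : AddSubgroup (Fin d → ℤ)) (hΛ : Λ.index ≠ 0) :
    ∃ A : Matrix (Fin d) (Fin d) ℤ, A.det.natAbs = Λ.index ∧
      ∃ e : Λ ≃+ (Fin d → ℤ), ∀ x : Λ, A.mulVec (e x) = (x : Fin d → ℤ) := by
  have : Λ.FiniteIndex := ⟨hΛ⟩
  have hrank : Module.finrank ℤ Λ = d := by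
    rw [AddSubgroup.finrank_eq_of_finiteIndex]; simp
  let b : Module.Basis (Fin d) ℤ Λ.toIntSubmodule := Module.finBasisOfFinrankEq ℤ _ hrank
  refine ⟨Matrix.of fun i j => (b j : Fin d → ℤ) i, ?_, b.equivFun.toAddEquiv, fun x => ?_⟩
  · rw [AddSubgroup.index_eq_natAbs_det (Pi.basisFun ℤ (Fin d)) Λ b, Module.Basis.det_apply]
    congr 2
  · have h := congrArg (Subtype.val : Λ.toIntSubmodule → _) (b.sum_equivFun x)
    rw [AddSubmonoidClass.coe_finsetSum] at h
    rw [← h]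
    ext i
    simp only [Matrix.mulVec, dotProduct, Matrix.of_apply, Finset.sum_apply]
    exact Finset.sum_congr rfl fun j _ => mul_comm _ _

end LatticeWalk

namespace FiniteRangeWalk

variable {d : ℕ} (W : FiniteRangeWalk d)

theorem mem_V {v : Fin d → ℤ} : v ∈ W.V ↔ 0 < W.p v := by
  rw [V, Set.Finite.mem_toFinset, Function.mem_support]
  exact ⟨fun h => (W.nonneg v).lt_of_ne' h, fun h => h.ne'⟩

theorem sum_V : ∑ v ∈ W.V, W.p v = 1 := by
  rw [← W.hasSum_one.tsum_eq]
  refine (tsum_eq_sum fun v hv => ?_).symm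
  rw [mem_V, not_lt] at hv
  exact le_antisymm hv (W.nonneg v)

theorem V_nonempty : W.V.Nonempty := by
  rw [Finset.nonempty_iff_ne_empty]
  intro h
  have := W.sum_V
  rw [h] at this
  simp at this

theorem step_succ (n : ℕ) (x : Fin d → ℤ) :
    W.step (n + 1) x = ∑ v ∈ W.V, W.p v * W.step n (x - v) := by
  rw [step, ← (Equiv.subLeft x).tsum_eq]
  simp only [Equiv.subLeft_apply, sub_sub_cancel]
  rw [tsum_eq_sum (s := W.V)]
  · exact Finset.sum_congr rfl fun v _ => mul_comm _ _
  · intro v hv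
    rw [mem_V, not_lt] at hv
    rw [le_antisymm hv (W.nonneg v), mul_zero]

theorem step_zero (x : Fin d → ℤ) : W.step 0 x = if x = 0 then 1 else 0 := rfl

theorem step_nonneg (n : ℕ) (x : Fin d → ℤ) : 0 ≤ W.step n x := by
  induction n generalizing x with
  | zero => rw [step_zero]; split_ifs <;> norm_num
  | succ n ih =>
    rw [step_succ]
    exact Finset.sum_nonneg fun v _ => mul_nonneg (W.nonneg v) (ih _)

theorem step_succ_pos_iff {n : ℕ} {x : Fin d → ℤ} :
    0 < W.step (n + 1) x ↔ ∃ v ∈ W.V, 0 < W.step n (x - v) := by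
  rw [step_succ, Finset.sum_pos_iff_of_nonneg
    fun v _ => mul_nonneg (W.nonneg v) (W.step_nonneg _ _)]
  refine exists_congr fun v => and_congr_right fun hv => ?_
  exact mul_pos_iff_of_pos_left (W.mem_V.1 hv)

theorem step_one_pos {v : Fin d → ℤ} (hv : v ∈ W.V) : 0 < W.step 1 v := by
  rw [step_succ_pos_iff]
  exact ⟨v, hv, by simp [step_zero]⟩

theorem step_add_pos {n m : ℕ} {x y : Fin d → ℤ} (hx : 0 < W.step n x) (hy : 0 < W.step m y) :
    0 < W.step (n + m) (x + y) := by
  induction m generalizing y with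
  | zero =>
    rw [step_zero] at hy
    split_ifs at hy with h
    · simpa [h] using hx
    · exact absurd hy (lt_irrefl _)
  | succ m ih =>
    obtain ⟨v, hv, h⟩ := W.step_succ_pos_iff.1 hy
    rw [← add_assoc, step_succ_pos_iff]
    exact ⟨v, hv, by rw [add_sub_assoc]; exact ih h⟩

theorem period_dvd_of_step_zero_pos {n : ℕ} (h : 0 < W.step n 0) : W.period ∣ n := by
  rcases Nat.eq_zero_or_pos n with rfl | hn
  · exact dvd_zero _
  · exact Nat.setGcd_dvd_of_mem ⟨hn, h⟩

variable {W}

namespace Irreducible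

theorem period_pos (hW : W.Irreducible) : 0 < W.period := by
  obtain ⟨n, hn, h⟩ := hW 0
  exact Nat.pos_of_dvd_of_pos (W.period_dvd_of_step_zero_pos h) hn

theorem modEq_of_step_pos (hW : W.Irreducible) {n m : ℕ} {x : Fin d → ℤ}
    (hn : 0 < W.step n x) (hm : 0 < W.step m x) : n ≡ m [MOD W.period] := by
  obtain ⟨k, -, hk⟩ := hW (-x)
  have h1 := W.period_dvd_of_step_zero_pos (by simpa using W.step_add_pos hn hk)
  have h2 := W.period_dvd_of_step_zero_pos (by simpa using W.step_add_pos hm hk)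
  have h3 : n + k ≡ m + k [MOD W.period] :=
    ((Nat.modEq_zero_iff_dvd).2 h1).trans ((Nat.modEq_zero_iff_dvd).2 h2).symm
  exact Nat.ModEq.add_right_cancel' k h3

/-- The homomorphism to `ℤ / r` sending a point to the class of the times at which it can be
visited. -/
noncomputable def residue (hW : W.Irreducible) : (Fin d → ℤ) →+ ZMod W.period :=
  AddMonoidHom.mk' (fun x => ((hW x).choose : ZMod W.period)) fun x y => by
    rw [← Nat.cast_add, ZMod.natCast_eq_natCast_iff]
    exact hW.modEq_of_step_pos (hW (x + y)).choose_spec.2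
      (W.step_add_pos (hW x).choose_spec.2 (hW y).choose_spec.2)

theorem residue_eq (hW : W.Irreducible) {n : ℕ} {x : Fin d → ℤ} (h : 0 < W.step n x) :
    hW.residue x = n := by
  change ((hW x).choose : ZMod W.period) = n
  rw [ZMod.natCast_eq_natCast_iff]
  exact hW.modEq_of_step_pos (hW x).choose_spec.2 h

theorem residue_surjective (hW : W.Irreducible) : Function.Surjective hW.residue := by
  obtain ⟨v, hv⟩ := W.V_nonempty
  intro z
  have := hW.period_pos
  have : NeZero W.period := ⟨this.ne'⟩
  refine ⟨z.val • v, ?_⟩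
  rw [map_nsmul, hW.residue_eq (W.step_one_pos hv)]
  simp

theorem index_ker_residue (hW : W.Irreducible) : hW.residue.ker.index = W.period := by
  rw [AddSubgroup.index_ker, AddMonoidHom.range_eq_top_of_surjective _ hW.residue_surjective,
    AddSubgroup.card_top, Nat.card_zmod]

end Irreducible

theorem sub_nsmul_mem_closure {v₀ : Fin d → ℤ} {n : ℕ} {x : Fin d → ℤ} (h : 0 < W.step n x) :
    x - n • v₀ ∈ AddSubgroup.closure ((fun v => v - v₀) '' (W.V : Set (Fin d → ℤ))) := by
  induction n generalizing x with
  | zero =>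
    rw [step_zero] at h
    split_ifs at h with h0
    · simp [h0]
    · exact absurd h (lt_irrefl _)
  | succ n ih =>
    obtain ⟨v, hv, h⟩ := W.step_succ_pos_iff.1 h
    have e : x - (n + 1) • v₀ = (x - v - n • v₀) + (v - v₀) := by rw [add_smul, one_smul]; abel
    rw [e]
    exact add_mem (ih h) (AddSubgroup.subset_closure ⟨v, hv, rfl⟩)

theorem period_nsmul_mem_closure (v₀ : Fin d → ℤ) :
    W.period • v₀ ∈ AddSubgroup.closure ((fun v => v - v₀) '' (W.V : Set (Fin d → ℤ))) := by
  set Λ := AddSubgroup.closure ((fun v => v - v₀) '' (W.V : Set (Fin d → ℤ))) with hΛ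
  let I : Ideal ℤ := AddSubgroup.toIntSubmodule (Λ.comap (zmultiplesHom _ v₀))
  have hI : ∀ k : ℤ, k ∈ I ↔ k • v₀ ∈ Λ := fun k => Iff.rfl
  have h : Ideal.span {(W.period : ℤ)} ≤ I := by
    rw [period, Nat.span_singleton_setGcd, Ideal.span_le]
    rintro _ ⟨n, ⟨-, hn⟩, rfl⟩
    rw [SetLike.mem_coe, hI]
    have := neg_mem (sub_nsmul_mem_closure (v₀ := v₀) hn)
    simpa using this
  have := (hI W.period).1 (h (Ideal.mem_span_singleton_self _))
  simpa using this

/-- The differences of the steps generate the kernel of the residue map. -/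
theorem Irreducible.closure_sub_eq_ker_residue (hW : W.Irreducible) {v₀ : Fin d → ℤ}
    (hv₀ : v₀ ∈ W.V) :
    AddSubgroup.closure ((fun v => v - v₀) '' (W.V : Set (Fin d → ℤ))) = hW.residue.ker := by
  refine le_antisymm ?_ fun x hx => ?_
  · rw [AddSubgroup.closure_le]
    rintro _ ⟨v, hv, rfl⟩
    rw [SetLike.mem_coe, AddMonoidHom.mem_ker, map_sub, hW.residue_eq (W.step_one_pos hv),
      hW.residue_eq (W.step_one_pos hv₀), sub_self]
  · obtain ⟨n, -, hn⟩ := hW x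
    rw [AddMonoidHom.mem_ker, hW.residue_eq hn, ZMod.natCast_eq_zero_iff] at hx
    obtain ⟨k, rfl⟩ := hx
    have h1 := sub_nsmul_mem_closure (v₀ := v₀) hn
    have h2 := nsmul_mem (W.period_nsmul_mem_closure v₀) k
    rw [smul_smul, mul_comm] at h2
    simpa using add_mem h1 h2

/-- A point of the class `X_j` is visited only at times congruent to `j`. -/
theorem Irreducible.modEq_of_mem_aperiodicClass (hW : W.Irreducible) {j n : ℕ} {x : Fin d → ℤ}
    (hx : x ∈ W.aperiodicClass j) (hn : 0 < W.step n x) : n ≡ j [MOD W.period] := by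
  obtain ⟨k, hk⟩ := hx
  refine (hW.modEq_of_step_pos hn hk).trans ?_
  simp [Nat.ModEq]

/-- Coordinates on the coset of the period lattice visited at a given time: there is an integer
matrix of determinant `± r` such that every step is `v = v₀ + A (c v)`, the `c v` generating
`ℤ ^ d`. -/
theorem Irreducible.exists_coordinates (hW : W.Irreducible) (v₀ : W.V) :
    ∃ (A : Matrix (Fin d) (Fin d) ℤ) (c : W.V → Fin d → ℤ), A.det.natAbs = W.period ∧
      AddSubgroup.closure (Set.range c) = ⊤ ∧ c v₀ = 0 ∧
      (∀ v : W.V, (v : Fin d → ℤ) = v₀ + A.mulVec (c v)) ∧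
      ∀ (j n : ℕ) (x : Fin d → ℤ), n ≡ j [MOD W.period] → x ∈ W.aperiodicClass j →
        ∃ y, x = n • (v₀ : Fin d → ℤ) + A.mulVec y := by
  obtain ⟨A, hA, e, he⟩ := LatticeWalk.exists_matrix_of_index_ne_zero hW.residue.ker (by
    rw [hW.index_ker_residue]; exact hW.period_pos.ne')
  have hcl := hW.closure_sub_eq_ker_residue v₀.2
  have hmem : ∀ v : W.V, (v : Fin d → ℤ) - v₀ ∈ hW.residue.ker := fun v => by
    rw [← hcl]; exact AddSubgroup.subset_closure ⟨v, v.2, rfl⟩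
  refine ⟨A, fun v => e ⟨v - v₀, hmem v⟩, by rw [hA, hW.index_ker_residue], ?_, ?_, ?_, ?_⟩
  · rw [eq_top_iff]
    rintro y -
    set C := AddSubgroup.closure (Set.range fun v : W.V => e ⟨v - v₀, hmem v⟩) with hC
    have key : hW.residue.ker ≤ (C.comap e.toAddMonoidHom).map hW.residue.ker.subtype := by
      refine hcl.ge.trans ?_
      rw [AddSubgroup.closure_le]
      rintro _ ⟨v, hv, rfl⟩
      refine ⟨⟨v - v₀, hmem ⟨v, hv⟩⟩, ?_, rfl⟩
      exact AddSubgroup.subset_closure ⟨⟨v, hv⟩, rfl⟩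
    obtain ⟨x, hx, hxy⟩ := key (e.symm y).2
    have : x = e.symm y := Subtype.ext hxy
    rw [this] at hx
    simpa using hx
  · have : (⟨(v₀ : Fin d → ℤ) - v₀, hmem v₀⟩ : hW.residue.ker) = 0 := Subtype.ext (sub_self _)
    exact (congrArg e this).trans (map_zero e)
  · intro v
    rw [he]
    exact (add_sub_cancel _ _).symm
  · intro j n x hnj ⟨k, hk⟩
    have hx : x - n • (v₀ : Fin d → ℤ) ∈ hW.residue.ker := by
      rw [AddMonoidHom.mem_ker, map_sub, map_nsmul, hW.residue_eq (W.step_one_pos v₀.2),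
        hW.residue_eq hk]
      have : ((j + k * W.period : ℕ) : ZMod W.period) = (n : ZMod W.period) := by
        rw [ZMod.natCast_eq_natCast_iff]
        refine Nat.ModEq.trans ?_ hnj.symm
        simp [Nat.ModEq]
      rw [this]; simp
    exact ⟨e ⟨_, hx⟩, by rw [he]; exact (add_sub_cancel _ _).symm⟩

end FiniteRangeWalk

/-! ### Exponential tilting and Fourier inversion -/

namespace LatticeWalk

open MeasureTheory

theorem integral_character {d : ℕ} (y : Fin d → ℤ) :
    ∫ θ in Set.Icc (fun _ : Fin d => -Real.pi) (fun _ => Real.pi), character θ y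
      = if y = 0 then ((2 * Real.pi) ^ d : ℂ) else 0 := by
  have h1 : ∀ θ : Fin d → ℝ, character θ y = ∏ i, Complex.exp (Complex.I * y i * θ i) := by
    intro θ
    rw [character, pairing_apply, ← Complex.exp_sum]
    congr 1
    push_cast
    rw [Finset.mul_sum]
    exact Finset.sum_congr rfl fun i _ => by ring
  have h2 : ∀ k : ℤ, ∫ t in Set.Icc (-Real.pi) Real.pi, Complex.exp (Complex.I * k * t)
      = if k = 0 then (2 * Real.pi : ℂ) else 0 := by
    intro k
    rw [integral_Icc_eq_integral_Ioc,
      ← intervalIntegral.integral_of_le (by linarith [Real.pi_pos])]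
    split_ifs with hk
    · simp [hk]; ring
    · have hk' : (Complex.I * k : ℂ) ≠ 0 := mul_ne_zero Complex.I_ne_zero (by exact_mod_cast hk)
      rw [integral_exp_mul_complex hk', div_eq_zero_iff]
      left
      rw [sub_eq_zero, Complex.exp_eq_exp_iff_exists_int]
      exact ⟨k, by push_cast; ring⟩
  rw [← Set.pi_univ_Icc, volume_pi, Measure.restrict_pi_pi]
  simp only [h1]
  rw [integral_fintype_prod_eq_prod
    (f := fun (i : Fin d) (t : ℝ) => Complex.exp (Complex.I * y i * t))]
  simp only [h2]
  split_ifs with hy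
  · simp [hy]
  · obtain ⟨i, hi⟩ := Function.ne_iff.1 hy
    exact Finset.prod_eq_zero (Finset.mem_univ i) (if_neg hi)

end LatticeWalk

namespace FiniteRangeWalk

open LatticeWalk MeasureTheory

variable {d : ℕ} (W : FiniteRangeWalk d)

/-- The weights of the exponentially tilted walk, `p(v) e^{⟨s, v⟩} / κ(s)`. -/
noncomputable def tilt (s : EuclideanSpace ℝ (Fin d)) (v : Fin d → ℤ) : ℝ :=
  W.p v * Real.exp (inner ℝ s (latticePoint v)) / W.kappa s

theorem kappa_pos (s : EuclideanSpace ℝ (Fin d)) : 0 < W.kappa s :=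
  Finset.sum_pos (fun _ hv => mul_pos (W.mem_V.1 hv) (Real.exp_pos _)) W.V_nonempty

theorem tilt_pos (s : EuclideanSpace ℝ (Fin d)) {v : Fin d → ℤ} (hv : v ∈ W.V) :
    0 < W.tilt s v :=
  div_pos (mul_pos (W.mem_V.1 hv) (Real.exp_pos _)) (W.kappa_pos s)

theorem sum_tilt (s : EuclideanSpace ℝ (Fin d)) : ∑ v ∈ W.V, W.tilt s v = 1 := by
  simp only [tilt]
  rw [← Finset.sum_div]
  exact div_self (W.kappa_pos s).ne'

theorem _root_.latticePoint_sub {d : ℕ} (x y : Fin d → ℤ) :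
    latticePoint (x - y) = latticePoint x - latticePoint y := by
  ext i; simp [latticePoint]

/-- The transition density of the exponentially tilted walk. -/
noncomputable def tiltedStep (s : EuclideanSpace ℝ (Fin d)) (n : ℕ) (x : Fin d → ℤ) : ℝ :=
  W.step n x * Real.exp (inner ℝ s (latticePoint x)) / W.kappa s ^ n

theorem tiltedStep_zero (s : EuclideanSpace ℝ (Fin d)) (x : Fin d → ℤ) :
    W.tiltedStep s 0 x = if x = 0 then 1 else 0 := by
  rw [tiltedStep, step_zero]
  split_ifs with h
  · have : latticePoint (0 : Fin d → ℤ) = 0 := by ext i; simp [latticePoint]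
    simp [h, this]
  · simp

theorem tiltedStep_succ (s : EuclideanSpace ℝ (Fin d)) (n : ℕ) (x : Fin d → ℤ) :
    W.tiltedStep s (n + 1) x = ∑ v ∈ W.V, W.tilt s v * W.tiltedStep s n (x - v) := by
  simp only [tiltedStep, tilt, step_succ]
  rw [Finset.sum_mul, Finset.sum_div]
  refine Finset.sum_congr rfl fun v _ => ?_
  have : Real.exp (inner ℝ s (latticePoint x))
      = Real.exp (inner ℝ s (latticePoint v)) * Real.exp (inner ℝ s (latticePoint (x - v))) := by
    rw [← Real.exp_add, latticePoint_sub, inner_sub_right]; congr 1; ring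
  rw [this, pow_succ, div_mul_div_comm]
  congr 1
  · ring
  · ring

variable {W}

/-- Fourier inversion for the tilted walk, in the coordinates `x = n v₀ + A y` of the coset visited
at time `n`. -/
theorem integral_charSum_pow_mul_character {s : EuclideanSpace ℝ (Fin d)} {v₀ : W.V}
    {A : Matrix (Fin d) (Fin d) ℤ} (hA : A.det ≠ 0) {c : W.V → Fin d → ℤ}
    (hc : ∀ v : W.V, (v : Fin d → ℤ) = v₀ + A.mulVec (c v)) (n : ℕ) (y : Fin d → ℤ) :
    ∫ θ in Set.Icc (fun _ : Fin d => -Real.pi) (fun _ => Real.pi),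
        charSum (fun v : W.V => W.tilt s v) c θ ^ n * character θ (-y)
      = (2 * Real.pi) ^ d * (W.tiltedStep s n (n • (v₀ : Fin d → ℤ) + A.mulVec y) : ℂ) := by
  induction n generalizing y with
  | zero =>
    simp only [pow_zero, one_mul, zero_smul, zero_add]
    rw [integral_character, tiltedStep_zero]
    have : A.mulVec y = 0 ↔ -y = 0 := by
      rw [neg_eq_zero]
      exact ⟨fun h => Matrix.eq_zero_of_mulVec_eq_zero hA h, fun h => by rw [h, Matrix.mulVec_zero]⟩
    simp only [this]
    split_ifs <;> simp
  | succ n ih =>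
    have e : ∀ θ : Fin d → ℝ, charSum (fun v : W.V => W.tilt s v) c θ ^ (n + 1) * character θ (-y)
        = ∑ v : W.V, W.tilt s v • (charSum (fun v : W.V => W.tilt s v) c θ ^ n
          * character θ (-(y - c v))) := by
      intro θ
      rw [pow_succ, mul_assoc, mul_comm (charSum _ _ _) (character _ _), ← mul_assoc]
      conv_lhs => arg 2; rw [charSum]
      rw [Finset.mul_sum]
      refine Finset.sum_congr rfl fun v _ => ?_
      rw [neg_sub, sub_eq_add_neg, character_add, mul_smul_comm]
      congr 1; ring
    simp only [e]
    rw [integral_finsetSum]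
    · simp only [integral_smul, ih]
      rw [tiltedStep_succ, ← Finset.sum_coe_sort W.V]
      push_cast
      rw [Finset.mul_sum]
      refine Finset.sum_congr rfl fun v _ => ?_
      have : (n + 1) • (v₀ : Fin d → ℤ) + A.mulVec y - v
          = n • (v₀ : Fin d → ℤ) + A.mulVec (y - c v) := by
        conv_lhs => rw [hc v]
        rw [Matrix.mulVec_sub, add_smul, one_smul]; abel
      rw [this, Complex.real_smul]; ring
    · intro v _
      have h1 := continuous_charSum (fun v : W.V => W.tilt s v) c
      have h2 := continuous_character (-(y - c v))
      have h3 : Continuous fun θ : Fin d → ℝ => W.tilt s v •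
          (charSum (fun v : W.V => W.tilt s v) c θ ^ n * character θ (-(y - c v))) :=
        ((h1.pow n).mul h2).const_smul (W.tilt s v)
      exact h3.continuousOn.integrableOn_compact isCompact_Icc

end FiniteRangeWalk

/-! ### The gradient of log κ and the geometry of its range -/

namespace FiniteRangeWalk

open LatticeWalk Filter Topology

variable {d : ℕ} (W : FiniteRangeWalk d)

/-- The mean of the tilted step distribution. -/
noncomputable def tiltMean (s : EuclideanSpace ℝ (Fin d)) : EuclideanSpace ℝ (Fin d) :=
  ∑ v ∈ W.V, W.tilt s v • latticePoint v

theorem inner_tiltMean (s u : EuclideanSpace ℝ (Fin d)) :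
    inner ℝ u (W.tiltMean s) = ∑ v ∈ W.V, W.tilt s v * inner ℝ u (latticePoint v) := by
  simp [tiltMean, inner_sum, real_inner_smul_right]

theorem hasFDerivAt_inner_left (s l : EuclideanSpace ℝ (Fin d)) :
    HasFDerivAt (fun x => inner ℝ x l) (innerSL ℝ l) s := by
  simp only [real_inner_comm l, ← innerSL_apply_apply ℝ]
  exact (innerSL ℝ l).hasFDerivAt

theorem hasFDerivAt_exp_inner (s l : EuclideanSpace ℝ (Fin d)) :
    HasFDerivAt (fun x => Real.exp (inner ℝ x l)) (Real.exp (inner ℝ s l) • innerSL ℝ l) s := by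
  exact (hasFDerivAt_inner_left s l).exp

theorem hasFDerivAt_kappa (s : EuclideanSpace ℝ (Fin d)) :
    HasFDerivAt W.kappa (W.kappa s • innerSL ℝ (W.tiltMean s)) s := by
  have h : HasFDerivAt W.kappa (∑ v ∈ W.V, W.p v •
      (Real.exp (inner ℝ s (latticePoint v)) • innerSL ℝ (latticePoint v))) s :=
    HasFDerivAt.fun_sum fun v _ => (hasFDerivAt_exp_inner s (latticePoint v)).const_mul (W.p v)
  convert! h using 1
  have := (W.kappa_pos s).ne'
  rw [tiltMean, map_sum, Finset.smul_sum]
  refine Finset.sum_congr rfl fun v _ => ?_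
  rw [map_smul, smul_smul, smul_smul, tilt, mul_div_cancel₀ _ this]

theorem hasFDerivAt_logKappa (s : EuclideanSpace ℝ (Fin d)) :
    HasFDerivAt W.logKappa (innerSL ℝ (W.tiltMean s)) s := by
  have := (W.hasFDerivAt_kappa s).log (W.kappa_pos s).ne'
  rwa [smul_smul, inv_mul_cancel₀ (W.kappa_pos s).ne', one_smul] at this

theorem gradient_logKappa (s : EuclideanSpace ℝ (Fin d)) :
    gradient W.logKappa s = W.tiltMean s := by
  rw [gradient, (W.hasFDerivAt_logKappa s).fderiv]
  exact (InnerProductSpace.toDual ℝ _).symm_apply_apply _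

theorem continuous_logKappa : Continuous W.logKappa :=
  continuous_iff_continuousAt.2 fun s => (W.hasFDerivAt_logKappa s).continuousAt

theorem hasFDerivAt_tilt (s : EuclideanSpace ℝ (Fin d)) (v : Fin d → ℤ) :
    HasFDerivAt (fun x => W.tilt x v)
      (W.tilt s v • innerSL ℝ (latticePoint v - W.tiltMean s)) s := by
  have heq : ∀ x, W.tilt x v = W.p v * Real.exp (inner ℝ x (latticePoint v) - W.logKappa x) := by
    intro x
    rw [tilt, Real.exp_sub, logKappa, Real.exp_log (W.kappa_pos x), mul_div_assoc]
  have h := ((hasFDerivAt_inner_left s (latticePoint v)).sub (W.hasFDerivAt_logKappa s)).exp.const_mul (W.p v)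
  rw [smul_smul, ← map_sub] at h
  simp only [heq]
  exact h

theorem tiltMean_apply (s : EuclideanSpace ℝ (Fin d)) (i : Fin d) :
    W.tiltMean s i = ∑ v ∈ W.V, W.tilt s v * (v i : ℝ) := by
  simp [tiltMean, latticePoint]

theorem inner_single_right (x : EuclideanSpace ℝ (Fin d)) (i : Fin d) :
    inner ℝ x (EuclideanSpace.single i (1 : ℝ)) = x i := by
  rw [EuclideanSpace.inner_single_right]; simp

/-- The Hessian of `log κ` is the covariance matrix of the tilted step distribution. -/
theorem B_eq_covMatrix (s : EuclideanSpace ℝ (Fin d)) :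
    W.B s = covMatrix (fun v : W.V => W.tilt s v) (fun v => (v : Fin d → ℤ)) := by
  ext i j
  have h1 : (fun y => lineDeriv ℝ W.logKappa y (EuclideanSpace.single j (1 : ℝ)))
      = fun y => ∑ v ∈ W.V, W.tilt y v * (v j : ℝ) := by
    ext y
    rw [((W.hasFDerivAt_logKappa y).hasLineDerivAt _).lineDeriv, innerSL_apply_apply,
      inner_single_right, tiltMean_apply]
  have h2 : HasFDerivAt (fun y => ∑ v ∈ W.V, W.tilt y v * (v j : ℝ))
      (∑ v ∈ W.V, (v j : ℝ) • (W.tilt s v • innerSL ℝ (latticePoint v - W.tiltMean s))) s :=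
    HasFDerivAt.fun_sum fun v _ => (W.hasFDerivAt_tilt s v).mul_const _
  rw [B, hessianMatrix, Matrix.of_apply, h1, (h2.hasLineDerivAt _).lineDeriv]
  simp only [_root_.sum_apply, _root_.smul_apply,
    innerSL_apply_apply, inner_single_right, smul_eq_mul, PiLp.sub_apply, tiltMean_apply]
  rw [covMatrix, Matrix.of_apply,
    Finset.sum_coe_sort W.V (fun v => W.tilt s v * ((v i : ℝ) * v j)),
    Finset.sum_coe_sort W.V (fun v => W.tilt s v * (v i : ℝ)),
    Finset.sum_coe_sort W.V (fun v => W.tilt s v * (v j : ℝ)), Finset.mul_sum,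
    ← Finset.sum_sub_distrib]
  refine Finset.sum_congr rfl fun v _ => ?_
  simp only [latticePoint]
  ring

theorem log_p_add_inner_le_logKappa (u : EuclideanSpace ℝ (Fin d)) {v : Fin d → ℤ}
    (hv : v ∈ W.V) : Real.log (W.p v) + inner ℝ u (latticePoint v) ≤ W.logKappa u := by
  rw [logKappa, ← Real.log_exp (inner ℝ u (latticePoint v)),
    ← Real.log_mul (W.mem_V.1 hv).ne' (Real.exp_pos _).ne']
  refine Real.log_le_log (mul_pos (W.mem_V.1 hv) (Real.exp_pos _)) ?_
  exact Finset.single_le_sum (f := fun v => W.p v * Real.exp (inner ℝ u (latticePoint v)))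
    (fun v _ => mul_nonneg (W.nonneg v) (Real.exp_pos _).le) hv

variable {W}

/-- A linear functional which is constant on the support vanishes: being a multiple of the time
along the walk, it is zero because the walk returns, and then zero at all lattice points. -/
theorem Irreducible.eq_zero_of_inner_eq (hW : W.Irreducible) {h : EuclideanSpace ℝ (Fin d)} {L : ℝ}
    (hL : ∀ v ∈ W.V, inner ℝ h (latticePoint v) = L) : h = 0 := by
  have key : ∀ (n : ℕ) (x : Fin d → ℤ), 0 < W.step n x →
      inner ℝ h (latticePoint x) = n * L := by
    intro n
    induction n with
    | zero =>
      intro x hx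
      rw [step_zero] at hx
      split_ifs at hx with h0
      · have : latticePoint (0 : Fin d → ℤ) = 0 := by ext i; simp [latticePoint]
        simp [h0, this]
      · exact absurd hx (lt_irrefl _)
    | succ n ih =>
      intro x hx
      obtain ⟨v, hv, hx⟩ := W.step_succ_pos_iff.1 hx
      have := ih _ hx
      rw [latticePoint_sub, inner_sub_right, hL v hv] at this
      push_cast; linarith
  obtain ⟨n, hn, hn0⟩ := hW 0
  have h0 : latticePoint (0 : Fin d → ℤ) = 0 := by ext i; simp [latticePoint]
  have hL0 : L = 0 := by
    have := key n 0 hn0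
    rw [h0, inner_zero_right, eq_comm, mul_eq_zero] at this
    exact this.resolve_left (by positivity)
  ext i
  obtain ⟨n, -, hn⟩ := hW (Pi.single i 1)
  have := key n _ hn
  rw [hL0, mul_zero] at this
  have e : latticePoint (Pi.single i 1 : Fin d → ℤ) = EuclideanSpace.single i (1 : ℝ) := by
    ext j
    by_cases hj : j = i
    · subst hj; simp [latticePoint]
    · simp [latticePoint, hj]
  rw [e, inner_single_right] at this
  simpa using this

/-- Strict monotonicity of `∇ log κ`, in the form of strict monotonicity of the logarithm applied
to the ratio of two tilted distributions. -/
theorem Irreducible.tiltMean_injective (hW : W.Irreducible) :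
    Function.Injective W.tiltMean := by
  intro s s' hss
  have hlog : ∀ (s : EuclideanSpace ℝ (Fin d)), ∀ v ∈ W.V, Real.log (W.tilt s v)
      = Real.log (W.p v) + inner ℝ s (latticePoint v) - W.logKappa s := by
    intro s v hv
    rw [tilt, Real.log_div (mul_pos (W.mem_V.1 hv) (Real.exp_pos _)).ne' (W.kappa_pos s).ne',
      Real.log_mul (W.mem_V.1 hv).ne' (Real.exp_pos _).ne', Real.log_exp, logKappa]
  set L := W.logKappa s' - W.logKappa s with hL
  have hdiff : ∀ v ∈ W.V, Real.log (W.tilt s' v) - Real.log (W.tilt s v)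
      = inner ℝ (s' - s) (latticePoint v) - L := by
    intro v hv
    rw [hlog s' v hv, hlog s v hv, inner_sub_left, hL]; ring
  have hsum : ∑ v ∈ W.V, (W.tilt s' v - W.tilt s v)
      * (Real.log (W.tilt s' v) - Real.log (W.tilt s v)) = 0 := by
    calc _ = ∑ v ∈ W.V, (W.tilt s' v * inner ℝ (s' - s) (latticePoint v)
          - W.tilt s v * inner ℝ (s' - s) (latticePoint v)
          - (W.tilt s' v * L - W.tilt s v * L)) := Finset.sum_congr rfl fun v hv => by
            rw [hdiff v hv]; ring
      _ = 0 := by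
        rw [Finset.sum_sub_distrib, Finset.sum_sub_distrib, ← inner_tiltMean, ← inner_tiltMean,
          Finset.sum_sub_distrib, ← Finset.sum_mul, ← Finset.sum_mul, sum_tilt, sum_tilt, hss]
        ring
  have hnonneg : ∀ a b : ℝ, 0 < a → 0 < b → 0 ≤ (a - b) * (Real.log a - Real.log b) := by
    intro a b ha hb
    rcases le_total a b with h | h
    · exact mul_nonneg_of_nonpos_of_nonpos (sub_nonpos.2 h)
        (sub_nonpos.2 (Real.log_le_log ha h))
    · exact mul_nonneg (sub_nonneg.2 h) (sub_nonneg.2 (Real.log_le_log hb h))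
  rw [Finset.sum_eq_zero_iff_of_nonneg fun v hv =>
    hnonneg _ _ (W.tilt_pos s' hv) (W.tilt_pos s hv)] at hsum
  have := hW.eq_zero_of_inner_eq (h := s' - s) (L := L) fun v hv => by
    have h0 : Real.log (W.tilt s' v) - Real.log (W.tilt s v) = 0 := by
      rcases mul_eq_zero.1 (hsum v hv) with h | h
      · rw [sub_eq_zero.1 h, sub_self]
      · exact h
    rw [hdiff v hv] at h0
    linarith
  exact (sub_eq_zero.1 this).symm

/-- The ball around `δ` up to the boundary of `M` lies in `M`, so a half-space containing the
support leaves room for it. -/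
theorem inner_add_infDist_mul_norm_le {δ u : EuclideanSpace ℝ (Fin d)} (hδ : δ ∈ W.M) {b : ℝ}
    (hb : ∀ v ∈ W.V, inner ℝ u (latticePoint v) ≤ b) :
    inner ℝ u δ + Metric.infDist δ (frontier W.M) * ‖u‖ ≤ b := by
  have hM : ∀ y ∈ W.M, inner ℝ u y ≤ b := by
    intro y hy
    have h1 : convexHull ℝ (latticePoint '' (W.V : Set (Fin d → ℤ))) ⊆ {y | inner ℝ u y ≤ b} := by
      refine convexHull_min ?_ (convex_halfSpace_le (innerSL ℝ u).toLinearMap.isLinear b)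
      rintro _ ⟨v, hv, rfl⟩
      exact hb v hv
    exact h1 (interior_subset hy)
  -- If `M` were the whole space, its boundary would be empty and `infDist` would be `0`.
  by_cases huniv : W.M = Set.univ
  · rw [huniv, frontier_univ, Metric.infDist_empty, zero_mul, add_zero]
    exact hM δ hδ
  obtain ⟨y, hy, hdist⟩ := exists_mem_frontier_infDist_compl_eq_dist hδ huniv
  have hD : Metric.infDist δ (frontier W.M) ≤ Metric.infDist δ W.Mᶜ := by
    rw [hdist]; exact Metric.infDist_le_dist_of_mem hy
  set D := Metric.infDist δ (frontier W.M) with hDdef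
  have hD0 : 0 ≤ D := Metric.infDist_nonneg
  rcases eq_or_ne u 0 with rfl | hu
  · simpa using hM δ hδ
  have hu0 : 0 < ‖u‖ := norm_pos_iff.2 hu
  rw [← le_sub_iff_add_le', ← le_div_iff₀ hu0]
  refine le_of_forall_lt fun t ht => ?_
  by_contra hcon
  have ht0 : 0 ≤ t := by
    refine le_trans ?_ (not_lt.1 hcon)
    exact div_nonneg (sub_nonneg.2 (hM δ hδ)) hu0.le
  obtain ⟨t', ht', ht'D⟩ := exists_between ht
  have hmem : δ + (t' / ‖u‖) • u ∈ W.M := by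
    by_contra hout
    have h1 : Metric.infDist δ W.Mᶜ ≤ dist δ (δ + (t' / ‖u‖) • u) :=
      Metric.infDist_le_dist_of_mem hout
    rw [dist_self_add_right, norm_smul, Real.norm_eq_abs,
      abs_of_nonneg (div_nonneg (ht0.trans ht'.le) hu0.le), div_mul_cancel₀ _ hu0.ne'] at h1
    linarith
  have h2 := hM _ hmem
  rw [inner_add_right, real_inner_smul_right, real_inner_self_eq_norm_sq] at h2
  have h3 : t' / ‖u‖ * ‖u‖ ^ 2 = t' * ‖u‖ := by field_simp
  rw [h3] at h2
  apply hcon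
  rw [lt_div_iff₀ hu0]
  nlinarith

theorem infDist_frontier_pos (hd : 1 ≤ d) {δ : EuclideanSpace ℝ (Fin d)} (hδ : δ ∈ W.M) :
    0 < Metric.infDist δ (frontier W.M) := by
  have hopen : IsOpen W.M := isOpen_interior
  have hne : (frontier W.M).Nonempty := by
    rw [nonempty_frontier_iff]
    -- `M` is bounded in the direction of a coordinate vector, hence not the whole space.
    refine ⟨⟨δ, hδ⟩, fun huniv => ?_⟩
    let u : EuclideanSpace ℝ (Fin d) := EuclideanSpace.single ⟨0, hd⟩ 1
    set b := ∑ v ∈ W.V, |inner ℝ u (latticePoint v)| with hb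
    have h := inner_add_infDist_mul_norm_le (W := W) (δ := (b + 1) • u) (u := u)
      (by rw [huniv]; trivial) (b := b) fun v hv => (le_abs_self _).trans
        (Finset.single_le_sum (f := fun v => |inner ℝ u (latticePoint v)|)
          (fun _ _ => abs_nonneg _) hv)
    rw [huniv, frontier_univ, Metric.infDist_empty, real_inner_smul_right,
      real_inner_self_eq_norm_sq] at h
    have : ‖u‖ = 1 := by simp [u]
    rw [this] at h
    linarith
  refine (isClosed_frontier.notMem_iff_infDist_pos hne).1 fun h => ?_
  rw [hopen.frontier_eq] at h
  exact h.2 hδ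

/-- The Legendre transform is attained at interior points: `log κ(u)` dominates every `⟨u, v⟩` up to
a constant, so `⟨u, δ⟩ - log κ(u) ≤ const - dist(δ, ∂M) |u|` is coercive. -/
theorem exists_forall_inner_sub_logKappa_le (hd : 1 ≤ d) {δ : EuclideanSpace ℝ (Fin d)}
    (hδ : δ ∈ W.M) :
    ∃ s, ∀ u, inner ℝ u δ - W.logKappa u ≤ inner ℝ s δ - W.logKappa s := by
  have hD := infDist_frontier_pos hd hδ
  set D := Metric.infDist δ (frontier W.M)
  set b := ∑ v ∈ W.V, |Real.log (W.p v)| with hb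
  have hbound : ∀ u, inner ℝ u δ - W.logKappa u ≤ b - D * ‖u‖ := by
    intro u
    have := inner_add_infDist_mul_norm_le (u := u) hδ (b := W.logKappa u + b) fun v hv => by
      have h1 := W.log_p_add_inner_le_logKappa u hv
      have h2 : -Real.log (W.p v) ≤ b := (neg_le_abs _).trans
        (Finset.single_le_sum (f := fun v => |Real.log (W.p v)|) (fun _ _ => abs_nonneg _) hv)
      linarith
    linarith
  have hcont : Continuous fun u : EuclideanSpace ℝ (Fin d) => inner ℝ u δ - W.logKappa u := by
    have := W.continuous_logKappa
    fun_prop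
  refine hcont.exists_forall_ge ?_
  refine tendsto_atBot_mono hbound ?_
  have h1 : Tendsto (fun u : EuclideanSpace ℝ (Fin d) => D * ‖u‖) (cocompact _) atTop :=
    (tendsto_norm_cocompact_atTop).const_mul_atTop hD
  simpa [sub_eq_add_neg] using tendsto_atBot_add_const_left _ b (tendsto_neg_atTop_atBot.comp h1)

theorem tiltMean_eq_of_forall_le {δ s : EuclideanSpace ℝ (Fin d)}
    (hs : ∀ u, inner ℝ u δ - W.logKappa u ≤ inner ℝ s δ - W.logKappa s) : W.tiltMean s = δ := by
  have h2 := (hasFDerivAt_inner_left s δ).sub (W.hasFDerivAt_logKappa s)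
  have hmax : IsLocalMax (fun u => inner ℝ u δ - W.logKappa u) s := Filter.Eventually.of_forall hs
  have h3 := hmax.hasFDerivAt_eq_zero h2
  rw [← map_sub] at h3
  have h4 := congrArg (fun f => f (δ - W.tiltMean s)) h3
  simp only [innerSL_apply_apply, _root_.zero_apply, inner_self_eq_zero] at h4
  exact (sub_eq_zero.1 h4).symm

theorem Irreducible.isGreatest_of_tiltMean_eq (hd : 1 ≤ d) (hW : W.Irreducible)
    {δ s : EuclideanSpace ℝ (Fin d)} (hδ : δ ∈ W.M) (hs : W.tiltMean s = δ) :
    IsGreatest (Set.range fun u : EuclideanSpace ℝ (Fin d) => inner ℝ u δ - W.logKappa u)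
      (inner ℝ s δ - W.logKappa s) := by
  obtain ⟨s', hs'⟩ := exists_forall_inner_sub_logKappa_le hd hδ
  obtain rfl : s = s' := hW.tiltMean_injective (hs.trans (tiltMean_eq_of_forall_le hs').symm)
  exact ⟨⟨s, rfl⟩, by rintro _ ⟨u, rfl⟩; exact hs' u⟩

/-- Tilting exponentially far sends the mean exponentially close to the boundary. Near a direction
`u₀`, the points of `V` off the face exposed by `u₀` have exponentially small weight, and only these
contribute to the distance of the mean from the supporting hyperplane; the unit sphere is compact. -/
theorem exists_infDist_frontier_le_exp (hd : 1 ≤ d) :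
    ∃ γ C : ℝ, 0 < γ ∧ 0 < C ∧ ∀ s : EuclideanSpace ℝ (Fin d), W.tiltMean s ∈ W.M →
      Metric.infDist (W.tiltMean s) (frontier W.M) ≤ C * Real.exp (-γ * ‖s‖) := by
  have hsphere : ∃ γ C : ℝ, 0 < γ ∧ 0 < C ∧
      ∀ u ∈ Metric.sphere (0 : EuclideanSpace ℝ (Fin d)) 1, ∀ t : ℝ, 0 ≤ t →
        W.tiltMean (t • u) ∈ W.M →
        Metric.infDist (W.tiltMean (t • u)) (frontier W.M) ≤ C * Real.exp (-γ * t) := by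
    refine (isCompact_sphere (0 : EuclideanSpace ℝ (Fin d)) 1).induction_on
      (p := fun S => ∃ γ C : ℝ, 0 < γ ∧ 0 < C ∧ ∀ u ∈ S, ∀ t : ℝ, 0 ≤ t →
        W.tiltMean (t • u) ∈ W.M →
        Metric.infDist (W.tiltMean (t • u)) (frontier W.M) ≤ C * Real.exp (-γ * t)) ?_ ?_ ?_ ?_
    · exact ⟨1, 1, one_pos, one_pos, fun u hu => absurd hu (Set.notMem_empty u)⟩
    · rintro S T hST ⟨γ, C, hγ, hC, h⟩
      exact ⟨γ, C, hγ, hC, fun u hu => h u (hST hu)⟩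
    · rintro S T ⟨γ, C, hγ, hC, h⟩ ⟨γ', C', hγ', hC', h'⟩
      refine ⟨min γ γ', max C C', lt_min hγ hγ', lt_max_of_lt_left hC, ?_⟩
      rintro u (hu | hu) t ht hmem
      · refine (h u hu t ht hmem).trans ?_
        gcongr
        · exact le_max_left _ _
        · exact min_le_left _ _
      · refine (h' u hu t ht hmem).trans ?_
        gcongr
        · exact le_max_right _ _
        · exact min_le_right _ _
    · intro u₀ hu₀
      rw [mem_sphere_zero_iff_norm] at hu₀
      obtain ⟨w, hw, hwmax⟩ := W.V.exists_max_image
        (fun v => inner ℝ u₀ (latticePoint v)) W.V_nonempty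
      set g : (Fin d → ℤ) → ℝ := fun v => inner ℝ u₀ (latticePoint w) - inner ℝ u₀ (latticePoint v)
        with hg
      have hg0 : ∀ v ∈ W.V, 0 ≤ g v := fun v hv => sub_nonneg.2 (hwmax v hv)
      obtain ⟨γ, hγV, hγ⟩ : ∃ γ : ℝ, (∀ v ∈ W.V, 0 < g v → γ < g v) ∧ 0 < γ := by
        have h1 : ∀ᶠ γ : ℝ in 𝓝[>] 0, ∀ v ∈ W.V, 0 < g v → γ < g v := by
          rw [Filter.eventually_all_finset]
          intro v _
          by_cases hv : 0 < g v
          · filter_upwards [nhdsWithin_le_nhds (Iio_mem_nhds hv)] with γ hγ _ using hγ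
          · exact Filter.Eventually.of_forall fun γ h => absurd h hv
        exact (h1.and self_mem_nhdsWithin).exists
      refine ⟨{u | ∀ v ∈ W.V, 0 < g v →
        γ < inner ℝ u (latticePoint w) - inner ℝ u (latticePoint v)}, ?_,
        γ, ∑ v ∈ W.V, W.p v / W.p w * g v + 1, hγ, ?_, ?_⟩
      · refine mem_nhdsWithin_of_mem_nhds ?_
        change ∀ᶠ u in 𝓝 u₀, _
        rw [Filter.eventually_all_finset]
        intro v hv
        by_cases hgv : 0 < g v
        · have hc : ContinuousAt (fun u : EuclideanSpace ℝ (Fin d) =>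
              inner ℝ u (latticePoint w) - inner ℝ u (latticePoint v)) u₀ := by fun_prop
          filter_upwards [hc.eventually_const_lt (hγV v hv hgv)] with u hu _ using hu
        · exact Filter.Eventually.of_forall fun u h => absurd h hgv
      · have : 0 ≤ ∑ v ∈ W.V, W.p v / W.p w * g v := Finset.sum_nonneg fun v hv =>
          mul_nonneg (div_nonneg (W.nonneg v) (W.nonneg w)) (hg0 v hv)
        linarith
      · intro u hu t ht hmem
        have h1 := inner_add_infDist_mul_norm_le (u := u₀) hmem
          (b := inner ℝ u₀ (latticePoint w)) hwmax
        rw [hu₀, mul_one] at h1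
        have h2 : inner ℝ u₀ (latticePoint w) - inner ℝ u₀ (W.tiltMean (t • u))
            = ∑ v ∈ W.V, W.tilt (t • u) v * g v := by
          simp only [hg, mul_sub, Finset.sum_sub_distrib]
          rw [← Finset.sum_mul, sum_tilt, one_mul, inner_tiltMean]
        have h3 : ∀ v ∈ W.V, W.tilt (t • u) v * g v
            ≤ W.p v / W.p w * g v * Real.exp (-γ * t) := by
          intro v hv
          rcases (hg0 v hv).eq_or_lt with h0 | h0
          · rw [← h0]; simp
          have hpw := W.mem_V.1 hw
          have hle : W.tilt (t • u) v ≤ W.p v / W.p w * Real.exp (-γ * t) := by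
            have hk : W.p w * Real.exp (inner ℝ (t • u) (latticePoint w)) ≤ W.kappa (t • u) :=
              Finset.single_le_sum
                (f := fun v => W.p v * Real.exp (inner ℝ (t • u) (latticePoint v)))
                (fun v _ => mul_nonneg (W.nonneg v) (Real.exp_pos _).le) hw
            calc W.tilt (t • u) v ≤ W.p v * Real.exp (inner ℝ (t • u) (latticePoint v))
                  / (W.p w * Real.exp (inner ℝ (t • u) (latticePoint w))) := by
                  rw [tilt]
                  have := W.nonneg v
                  gcongr
              _ = W.p v / W.p w * Real.exp (inner ℝ (t • u) (latticePoint v)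
                  - inner ℝ (t • u) (latticePoint w)) := by
                  rw [Real.exp_sub, mul_div_mul_comm]
              _ ≤ _ := by
                  have h4 := hu v hv h0
                  have := W.nonneg v
                  rw [real_inner_smul_left, real_inner_smul_left]
                  gcongr
                  nlinarith
          calc _ ≤ W.p v / W.p w * Real.exp (-γ * t) * g v := by gcongr
            _ = _ := by ring
        have h5 := Finset.sum_le_sum h3
        rw [← h2, ← Finset.sum_mul] at h5
        nlinarith [Real.exp_pos (-γ * t)]
  obtain ⟨γ, C, hγ, hC, h⟩ := hsphere
  refine ⟨γ, C, hγ, hC, fun s hs => ?_⟩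
  obtain ⟨u, hu, hsu⟩ : ∃ u ∈ Metric.sphere (0 : EuclideanSpace ℝ (Fin d)) 1, ‖s‖ • u = s := by
    rcases eq_or_ne s 0 with rfl | hs0
    · exact ⟨EuclideanSpace.single ⟨0, hd⟩ 1, by simp, by simp⟩
    · have : ‖s‖ ≠ 0 := norm_ne_zero_iff.2 hs0
      refine ⟨‖s‖⁻¹ • s, ?_, ?_⟩
      · rw [mem_sphere_zero_iff_norm, norm_smul, norm_inv, norm_norm, inv_mul_cancel₀ this]
      · rw [smul_smul, mul_inv_cancel₀ this, one_smul]
  have := h u hu ‖s‖ (norm_nonneg s)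
  rw [hsu] at this
  exact this hs

/-- All tilted weights are bounded below by a power of the distance of the mean to the boundary. -/
theorem exists_le_tilt (hd : 1 ≤ d) :
    ∃ c K : ℝ, 0 < c ∧ 1 ≤ K ∧ ∀ s : EuclideanSpace ℝ (Fin d), W.tiltMean s ∈ W.M →
      ∀ v ∈ W.V, c * Metric.infDist (W.tiltMean s) (frontier W.M) ^ K ≤ W.tilt s v := by
  obtain ⟨γ, C, hγ, hC, hD⟩ := exists_infDist_frontier_le_exp (W := W) hd
  obtain ⟨w, hw, hwmin⟩ := W.V.exists_min_image W.p W.V_nonempty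
  have hpw := W.mem_V.1 hw
  set R := ∑ v ∈ W.V, ‖latticePoint v‖ with hR
  have hR0 : 0 ≤ R := by positivity
  have hinner : ∀ (s : EuclideanSpace ℝ (Fin d)), ∀ v ∈ W.V,
      |inner ℝ s (latticePoint v)| ≤ R * ‖s‖ := by
    intro s v hv
    refine (abs_real_inner_le_norm _ _).trans ?_
    rw [mul_comm]
    gcongr
    exact Finset.single_le_sum (f := fun v => ‖latticePoint v‖) (fun _ _ => norm_nonneg _) hv
  -- The weights are at least of order `e^{-2R|s|} = (e^{-γ|s|}) ^ (2R/γ)`; the extra `1` only serves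
  -- to make the exponent at least `1`.
  set K := 2 * R / γ + 1 with hK
  have hK1 : 1 ≤ K := by rw [hK, le_add_iff_nonneg_left]; positivity
  refine ⟨W.p w * C⁻¹ ^ K, K, by positivity, hK1, fun s hs v hv => ?_⟩
  have hdist := hD s hs
  set D := Metric.infDist (W.tiltMean s) (frontier W.M)
  have hD0 : 0 ≤ D := Metric.infDist_nonneg
  have h1 : C⁻¹ ^ K * D ^ K ≤ Real.exp (-(2 * R) * ‖s‖) := by
    rw [← Real.mul_rpow (by positivity) hD0]
    calc (C⁻¹ * D) ^ K ≤ (Real.exp (-γ * ‖s‖)) ^ K := by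
          gcongr
          rw [inv_mul_le_iff₀ hC]; exact hdist
      _ ≤ _ := by
          have e : -γ * ‖s‖ * K = -(2 * R) * ‖s‖ - γ * ‖s‖ := by rw [hK]; field_simp; ring
          rw [← Real.exp_mul, e, Real.exp_le_exp]
          linarith [mul_nonneg hγ.le (norm_nonneg s)]
  have h2 : W.kappa s ≤ Real.exp (R * ‖s‖) := by
    calc W.kappa s ≤ ∑ v ∈ W.V, W.p v * Real.exp (R * ‖s‖) := by
          rw [kappa]
          refine Finset.sum_le_sum fun v hv => ?_
          have := W.nonneg v
          have := (abs_le.1 (hinner s v hv)).2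
          gcongr
      _ = _ := by rw [← Finset.sum_mul, sum_V, one_mul]
  calc _ = W.p w * (C⁻¹ ^ K * D ^ K) := by ring
    _ ≤ W.p w * Real.exp (-(2 * R) * ‖s‖) := by gcongr
    _ = W.p w * Real.exp (-(R * ‖s‖)) / Real.exp (R * ‖s‖) := by
        rw [mul_div_assoc, ← Real.exp_sub]; congr 2; ring
    _ ≤ W.tilt s v := by
        rw [tilt]
        have := W.nonneg v
        have := W.kappa_pos s
        have h3 := (abs_le.1 (hinner s v hv)).1
        have h4 := hwmin v hv
        gcongr

end FiniteRangeWalk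

/-! ### Change of lattice coordinates and conclusion -/

namespace LatticeWalk

open MeasureTheory

variable {d : ℕ} {ι : Type*} [Fintype ι]

theorem cast_add_mulVec (A : Matrix (Fin d) (Fin d) ℤ) (a y : Fin d → ℤ) (i : Fin d) :
    (((a + A.mulVec y) i : ℤ) : ℝ) = a i + ∑ k, (A i k : ℝ) * y k := by
  simp [Matrix.mulVec, dotProduct]

theorem covMatrix_eq_mul_mul_transpose {q : ι → ℝ} (hq : ∑ v, q v = 1)
    {x c : ι → Fin d → ℤ} {a : Fin d → ℤ} {A : Matrix (Fin d) (Fin d) ℤ}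
    (hx : ∀ v, x v = a + A.mulVec (c v)) :
    covMatrix q x = A.map (Int.cast : ℤ → ℝ) * covMatrix q c
      * (A.map (Int.cast : ℤ → ℝ)).transpose := by
  ext i j
  set u : ι → Fin d → ℝ := fun v i => ∑ k, (A i k : ℝ) * c v k with hu
  have hxu : ∀ v i, (x v i : ℝ) = a i + u v i := fun v i => by rw [hx v, cast_add_mulVec]
  have h1 : ∑ v, q v * ((x v i : ℝ) * x v j) - (∑ v, q v * (x v i : ℝ)) * ∑ v, q v * (x v j : ℝ)
      = ∑ v, q v * (u v i * u v j) - (∑ v, q v * u v i) * ∑ v, q v * u v j := by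
    have e1 : ∑ v, q v * ((x v i : ℝ) * x v j) = (a i : ℝ) * a j * ∑ v, q v
        + a i * ∑ v, q v * u v j + a j * ∑ v, q v * u v i + ∑ v, q v * (u v i * u v j) := by
      simp only [Finset.mul_sum, ← Finset.sum_add_distrib]
      exact Finset.sum_congr rfl fun v _ => by rw [hxu, hxu]; ring
    have e2 : ∀ i, ∑ v, q v * (x v i : ℝ) = (a i : ℝ) * ∑ v, q v + ∑ v, q v * u v i := by
      intro i
      simp only [Finset.mul_sum, ← Finset.sum_add_distrib]
      exact Finset.sum_congr rfl fun v _ => by rw [hxu]; ring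
    rw [e1, e2, e2, hq]; ring
  have h2 : ∀ i, ∑ v, q v * u v i = ∑ k, (A i k : ℝ) * ∑ v, q v * (c v k : ℝ) := by
    intro i
    simp only [hu, Finset.mul_sum]
    rw [Finset.sum_comm]
    exact Finset.sum_congr rfl fun _ _ => Finset.sum_congr rfl fun _ _ => by ring
  have h3 : ∑ v, q v * (u v i * u v j)
      = ∑ l, (∑ k, (A i k : ℝ) * (∑ v, q v * ((c v k : ℝ) * c v l))) * A j l := by
    have e : ∀ v, q v * (u v i * u v j)
        = ∑ k, ∑ l, (A i k : ℝ) * (q v * ((c v k : ℝ) * c v l)) * A j l := by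
      intro v
      rw [hu, Finset.sum_mul_sum, Finset.mul_sum]
      refine Finset.sum_congr rfl fun k _ => ?_
      rw [Finset.mul_sum]
      exact Finset.sum_congr rfl fun l _ => by ring
    rw [Finset.sum_congr rfl fun v _ => e v, Finset.sum_comm]
    simp only [Finset.sum_mul, Finset.mul_sum]
    rw [Finset.sum_comm (s := Finset.univ (α := Fin d)) (t := Finset.univ (α := Fin d))]
    refine Finset.sum_congr rfl fun k _ => ?_
    rw [Finset.sum_comm]
  have h4 : (∑ k, (A i k : ℝ) * ∑ v, q v * (c v k : ℝ)) * ∑ l, (A j l : ℝ) * ∑ v, q v * (c v l : ℝ)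
      = ∑ l, (∑ k, (A i k : ℝ) * ((∑ v, q v * (c v k : ℝ)) * ∑ v, q v * (c v l : ℝ))) * A j l := by
    rw [Finset.mul_sum]
    refine Finset.sum_congr rfl fun l _ => ?_
    rw [Finset.sum_mul, Finset.sum_mul]
    exact Finset.sum_congr rfl fun k _ => by ring
  rw [covMatrix, Matrix.of_apply, h1, h2, h2, h3, h4]
  simp only [Matrix.mul_apply, Matrix.map_apply, Matrix.transpose_apply, covMatrix,
    Matrix.of_apply, mul_sub, Finset.sum_sub_distrib, sub_mul]

theorem det_covMatrix_le {q : ι → ℝ} (hq0 : ∀ v, 0 ≤ q v) (hq : ∑ v, q v = 1)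
    (c : ι → Fin d → ℤ) :
    (covMatrix q c).det ≤ d.factorial * (2 * (∑ v, ∑ i, |(c v i : ℝ)|) ^ 2) ^ d := by
  set L := ∑ v, ∑ i, |(c v i : ℝ)| with hL
  have hc : ∀ v i, |(c v i : ℝ)| ≤ L := fun v i =>
    (Finset.single_le_sum (f := fun i => |(c v i : ℝ)|) (fun _ _ => abs_nonneg _)
      (Finset.mem_univ i)).trans
    (Finset.single_le_sum (f := fun v => ∑ i, |(c v i : ℝ)|)
      (fun _ _ => Finset.sum_nonneg fun _ _ => abs_nonneg _) (Finset.mem_univ v))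
  have hmean : ∀ (f : ι → ℝ) (M : ℝ), (∀ v, |f v| ≤ M) → |∑ v, q v * f v| ≤ M := by
    intro f M hf
    calc _ ≤ ∑ v, |q v * f v| := Finset.abs_sum_le_sum_abs _ _
      _ ≤ ∑ v, q v * M := Finset.sum_le_sum fun v _ => by
          rw [abs_mul, abs_of_nonneg (hq0 v)]
          exact mul_le_mul_of_nonneg_left (hf v) (hq0 v)
      _ = M := by rw [← Finset.sum_mul, hq, one_mul]
  have hL0 : 0 ≤ L := by positivity
  have hent : ∀ i j, AbsoluteValue.abs (covMatrix q c i j) ≤ 2 * L ^ 2 := by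
    intro i j
    change |covMatrix q c i j| ≤ _
    rw [covMatrix, Matrix.of_apply]
    refine (abs_sub _ _).trans ?_
    have h1 : |∑ v, q v * ((c v i : ℝ) * c v j)| ≤ L * L := hmean _ _ fun v => by
      rw [abs_mul]; gcongr <;> exact hc _ _
    have h2 : |(∑ v, q v * (c v i : ℝ)) * ∑ v, q v * (c v j : ℝ)| ≤ L * L := by
      rw [abs_mul]; gcongr <;> exact hmean _ _ fun v => hc _ _
    linarith
  have := Matrix.det_le hent
  rw [Fintype.card_fin, nsmul_eq_mul] at this
  exact (le_abs_self _).trans this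

end LatticeWalk

namespace FiniteRangeWalk

open LatticeWalk MeasureTheory

variable {d : ℕ} {W : FiniteRangeWalk d}

/-- If `x = n δ`, tilting multiplies the density by `e^{n (⟨s, δ⟩ - log κ(s))}`. -/
theorem tiltedStep_eq {s δ : EuclideanSpace ℝ (Fin d)} {n : ℕ} (hn : 1 ≤ n) {x : Fin d → ℤ}
    (hδ : δ = (n : ℝ)⁻¹ • latticePoint x) :
    W.tiltedStep s n x = W.step n x * Real.exp (n * (inner ℝ s δ - W.logKappa s)) := by
  have hn0 : (n : ℝ) ≠ 0 := by positivity
  rw [tiltedStep, mul_div_assoc, mul_sub, Real.exp_sub, hδ, real_inner_smul_right,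
    mul_inv_cancel_left₀ hn0, logKappa, Real.exp_nat_mul, Real.exp_log (W.kappa_pos s)]

/-- If the tilted mean is `x / n` with `x = n v₀ + A y`, the mean in the coordinates is `y / n`. -/
theorem natCast_mul_sum_tilt_eq {s : EuclideanSpace ℝ (Fin d)} {n : ℕ} (hn : 1 ≤ n)
    {v₀ : W.V} {A : Matrix (Fin d) (Fin d) ℤ} (hA : A.det ≠ 0) {c : W.V → Fin d → ℤ}
    (hc : ∀ v : W.V, (v : Fin d → ℤ) = v₀ + A.mulVec (c v)) {y : Fin d → ℤ}
    (hs : W.tiltMean s = (n : ℝ)⁻¹ • latticePoint (n • (v₀ : Fin d → ℤ) + A.mulVec y))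
    (i : Fin d) :
    n * ∑ v : W.V, W.tilt s v * (c v i : ℝ) = y i := by
  have hn0 : (n : ℝ) ≠ 0 := by positivity
  have hdet : (A.map (Int.cast : ℤ → ℝ)).det ≠ 0 := by
    have := RingHom.map_det (Int.castRingHom ℝ) A
    rw [RingHom.mapMatrix_apply] at this
    change (A.map (Int.castRingHom ℝ)).det ≠ 0
    rw [← this]; simpa using hA
  set w : Fin d → ℝ := fun i => n * ∑ v : W.V, W.tilt s v * (c v i : ℝ) - y i with hw
  suffices h : w = 0 from sub_eq_zero.1 (congrFun h i)
  refine Matrix.eq_zero_of_mulVec_eq_zero hdet (funext fun j => ?_)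
  have h1 := congrArg (fun z : EuclideanSpace ℝ (Fin d) => (n : ℝ) * z j) hs
  simp only [tiltMean_apply, PiLp.smul_apply, latticePoint, smul_eq_mul,
    mul_inv_cancel_left₀ hn0, cast_add_mulVec] at h1
  rw [← Finset.sum_coe_sort W.V] at h1
  have h2 : ∑ v : W.V, W.tilt s v * (((v : Fin d → ℤ) j : ℤ) : ℝ)
      = ((v₀ : Fin d → ℤ) j : ℝ) + ∑ k, (A j k : ℝ) * ∑ v : W.V, W.tilt s v * (c v k : ℝ) := by
    have e : ∀ v : W.V, W.tilt s v * (((v : Fin d → ℤ) j : ℤ) : ℝ)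
        = W.tilt s v * ((v₀ : Fin d → ℤ) j : ℝ)
          + ∑ k, (A j k : ℝ) * (W.tilt s v * (c v k : ℝ)) := by
      intro v
      have e' : (((v : Fin d → ℤ) j : ℤ) : ℝ)
          = ((v₀ : Fin d → ℤ) j : ℝ) + ∑ k, (A j k : ℝ) * c v k := by
        rw [← cast_add_mulVec, ← hc v]
      rw [e', mul_add, Finset.mul_sum]
      congr 1
      exact Finset.sum_congr rfl fun k _ => by ring
    rw [Finset.sum_congr rfl fun v _ => e v, Finset.sum_add_distrib, ← Finset.sum_mul,
      Finset.sum_coe_sort W.V (fun v => W.tilt s v), sum_tilt, one_mul, Finset.sum_comm]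
    simp only [Finset.mul_sum]
  rw [h2] at h1
  simp only [Matrix.mulVec, dotProduct, Matrix.map_apply, hw, mul_sub, Finset.sum_sub_distrib,
    Pi.zero_apply]
  have h3 : ∑ k, (A j k : ℝ) * (n * ∑ v : W.V, W.tilt s v * (c v k : ℝ))
      = n * ∑ k, (A j k : ℝ) * ∑ v : W.V, W.tilt s v * (c v k : ℝ) := by
    rw [Finset.mul_sum]
    exact Finset.sum_congr rfl fun k _ => by ring
  rw [h3]
  simp only [Pi.smul_apply, nsmul_eq_mul, Int.cast_mul, Int.cast_natCast] at h1
  linarith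


/-- The local limit theorem for the walk tilted so that its mean is the observed velocity. -/
theorem Irreducible.exists_abs_tiltedStep_sub_le (hW : W.Irreducible) :
    ∃ C : ℝ, 0 < C ∧ ∀ (s : EuclideanSpace ℝ (Fin d)) (m : ℝ), 0 < m →
      (∀ v ∈ W.V, m ≤ W.tilt s v) → 0 < (W.B s).det ∧
      ∀ (j n : ℕ) (x : Fin d → ℤ), 1 ≤ n → n ≡ j [MOD W.period] → x ∈ W.aperiodicClass j →
        W.tiltMean s = (n : ℝ)⁻¹ • latticePoint x →
        |(2 * Real.pi * n) ^ ((d : ℝ) / 2) * (W.B s).det ^ ((1 : ℝ) / 2) * W.tiltedStep s n x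
          - W.period| ≤ C * ((n : ℝ)⁻¹ * m⁻¹ ^ (3 + (d : ℝ) / 2)) := by
  obtain ⟨v₀, hv₀⟩ := W.V_nonempty
  obtain ⟨A, c, hdet, hgen, hc₀, hc, hcls⟩ := hW.exists_coordinates ⟨v₀, hv₀⟩
  have hA : A.det ≠ 0 := fun h => by
    have := hW.period_pos
    rw [h] at hdet; simp at hdet; omega
  obtain ⟨C, hC, hmain⟩ := exists_abs_integral_re_sub_le hgen hc₀
  have hr := hW.period_pos
  set r := W.period with hrdef
  have hr0 : (0 : ℝ) < r := by exact_mod_cast hr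
  set G : ℝ := d.factorial * (2 * (∑ v, ∑ i, |(c v i : ℝ)|) ^ 2) ^ d with hG
  have hG0 : 0 ≤ G := by positivity
  set P : ℝ := 2 * Real.pi with hP
  have hP0 : 0 < P := by positivity
  set h : ℝ := (d : ℝ) / 2 with hh
  refine ⟨r * (G + 1) ^ ((1 : ℝ) / 2) * (P⁻¹) ^ h * C, by positivity, fun s m hm hmq => ?_⟩
  have hq : ∑ v : W.V, W.tilt s v = 1 := by
    rw [Finset.sum_coe_sort W.V (fun v => W.tilt s v), sum_tilt]
  obtain ⟨hpos, hmain⟩ := hmain (fun v : W.V => W.tilt s v) m hm (fun v => hmq v v.2) hq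
  set S := covMatrix (fun v : W.V => W.tilt s v) c with hS
  have hS0 := hpos.det_pos
  have hdetB : (W.B s).det = (r : ℝ) ^ 2 * S.det := by
    have e : (A.map (Int.cast : ℤ → ℝ)).det = (A.det : ℝ) :=
      (RingHom.map_det (Int.castRingHom ℝ) A).symm
    have e2 : (A.det : ℝ) ^ 2 = (r : ℝ) ^ 2 := by
      rw [← hdet, Nat.cast_natAbs, Int.cast_abs, sq_abs]
    rw [B_eq_covMatrix, covMatrix_eq_mul_mul_transpose hq hc, Matrix.det_mul, Matrix.det_mul,
      Matrix.det_transpose, e, ← e2]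
    ring
  refine ⟨by rw [hdetB]; positivity, fun j n x hn hnj hx hmean => ?_⟩
  have hn0 : (0 : ℝ) < n := by exact_mod_cast hn
  obtain ⟨y, rfl⟩ := hcls j n x hnj hx
  set x := n • v₀ + A.mulVec y with hxdef
  have hF := integral_charSum_pow_mul_character (s := s) hA hc n y
  have hre : ∫ θ in Set.Icc (fun _ : Fin d => -Real.pi) (fun _ => Real.pi),
      (charSum (fun v : W.V => W.tilt s v) c θ ^ n * character θ (-y)).re
      = P ^ d * W.tiltedStep s n x := by
    have h1 := continuous_charSum (fun v : W.V => W.tilt s v) c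
    have h2 := continuous_character (-y)
    have h3 : Continuous fun θ : Fin d → ℝ =>
        charSum (fun v : W.V => W.tilt s v) c θ ^ n * character θ (-y) := (h1.pow n).mul h2
    have h4 := integral_re (𝕜 := ℂ) (h3.continuousOn.integrableOn_compact (μ := volume)
      (isCompact_Icc (a := fun _ : Fin d => -Real.pi) (b := fun _ => Real.pi)))
    refine h4.trans ?_
    rw [hF]
    have : (2 * (Real.pi : ℂ)) ^ d * (W.tiltedStep s n x : ℂ)
        = ((P ^ d * W.tiltedStep s n x : ℝ) : ℂ) := by rw [hP]; push_cast; ring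
    exact (congrArg Complex.re this).trans (Complex.ofReal_re _)
  have hbound := hmain n hn y (natCast_mul_sum_tilt_eq hn hA hc hmean)
  rw [hre] at hbound
  set T := W.tiltedStep s n x
  have hsq : (W.B s).det ^ ((1 : ℝ) / 2) = r * S.det ^ ((1 : ℝ) / 2) := by
    rw [hdetB, Real.mul_rpow (by positivity) hS0.le, ← Real.rpow_natCast, ← Real.rpow_mul hr0.le]
    norm_num
  have hSle : S.det ^ ((1 : ℝ) / 2) ≤ (G + 1) ^ ((1 : ℝ) / 2) := by
    have := det_covMatrix_le (q := fun v : W.V => W.tilt s v)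
      (fun v => (W.tilt_pos s v.2).le) hq c
    gcongr
    linarith
  have hPd : P ^ d = P ^ h * P ^ h := by
    rw [← Real.rpow_add hP0, ← Real.rpow_natCast]; congr 1; rw [hh]; ring
  have hPn : (P * n) ^ h = P ^ h * (n : ℝ) ^ h := Real.mul_rpow hP0.le hn0.le
  have hPdn : (P / n) ^ h = P ^ h * ((n : ℝ) ^ h)⁻¹ := by
    rw [Real.div_rpow hP0.le hn0.le]; rfl
  have hPh : 0 < P ^ h := by positivity
  have hnh : 0 < (n : ℝ) ^ h := by positivity
  have hSinv : S.det ^ (-(1 : ℝ) / 2) = (S.det ^ ((1 : ℝ) / 2))⁻¹ := by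
    rw [← Real.rpow_neg hS0.le]; norm_num
  have hSh : 0 < S.det ^ ((1 : ℝ) / 2) := by positivity
  have key : (P * n) ^ h * (W.B s).det ^ ((1 : ℝ) / 2) * T - r
      = r * S.det ^ ((1 : ℝ) / 2) * ((n : ℝ) ^ h * (P ^ h)⁻¹)
        * (P ^ d * T - (P / n) ^ h * S.det ^ (-(1 : ℝ) / 2)) := by
    rw [hsq, hPd, hPn, hPdn, hSinv]
    field_simp
  have hmn : ((m * n)⁻¹) ^ h = (m⁻¹) ^ h * ((n : ℝ) ^ h)⁻¹ := by
    rw [mul_inv, Real.mul_rpow (by positivity) (by positivity), Real.inv_rpow hn0.le]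
  have hm3 : m⁻¹ ^ (3 + h) = m⁻¹ ^ 3 * m⁻¹ ^ h := by
    rw [Real.rpow_add (by positivity)]
    congr 1
    exact_mod_cast Real.rpow_natCast m⁻¹ 3
  rw [key, abs_mul, abs_of_pos (by positivity)]
  calc _ ≤ r * (G + 1) ^ ((1 : ℝ) / 2) * ((n : ℝ) ^ h * (P ^ h)⁻¹)
        * (C * ((n : ℝ)⁻¹ * m⁻¹ ^ 3 * ((m * n)⁻¹) ^ h)) := by gcongr
    _ = _ := by
      rw [hmn, hm3, Real.inv_rpow hP0.le]
      field_simp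

end FiniteRangeWalk

theorem theorem3p1 (d : ℕ) (hd : 1 ≤ d) (W : FiniteRangeWalk d) (hW : W.Irreducible) :
    ∃ η : ℝ, 1 ≤ η ∧ ∃ C : ℝ, 0 < C ∧
      ∀ j : ℕ, j < W.period → ∀ n : ℕ, 1 ≤ n → ∀ x ∈ W.aperiodicClass j,
        (n ≡ j [MOD W.period] →
          ∀ δ : EuclideanSpace ℝ (Fin d), δ = (n : ℝ)⁻¹ • latticePoint x → δ ∈ W.M →
            (∃! s : EuclideanSpace ℝ (Fin d), gradient W.logKappa s = δ) ∧
            IsGreatest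
              (Set.range fun u : EuclideanSpace ℝ (Fin d) => inner ℝ u δ - W.logKappa u)
              (W.phi δ) ∧
            ∀ s : EuclideanSpace ℝ (Fin d), gradient W.logKappa s = δ →
              0 < (W.B s).det ∧
              ∃ E : ℝ,
                W.step n x =
                  (2 * Real.pi * (n : ℝ)) ^ (-(d : ℝ) / 2) * (W.B s).det ^ (-(1 : ℝ) / 2) *
                    Real.exp (-(n : ℝ) * W.phi δ) * ((W.period : ℝ) + E) ∧
                |E| ≤ C * ((n : ℝ)⁻¹ * Metric.infDist δ (frontier W.M) ^ (-2 * η))) ∧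
        (¬ n ≡ j [MOD W.period] → W.step n x = 0) := by
  obtain ⟨C, hC, hlim⟩ := hW.exists_abs_tiltedStep_sub_le
  obtain ⟨c, K, hc, hK, htilt⟩ := FiniteRangeWalk.exists_le_tilt (W := W) hd
  set α : ℝ := 3 + (d : ℝ) / 2 with hα
  have hα3 : 3 ≤ α := by rw [hα, le_add_iff_nonneg_right]; positivity
  refine ⟨K * α / 2, by nlinarith, C * c⁻¹ ^ α, by positivity, fun j _ n hn x hx => ⟨?_, ?_⟩⟩
  · intro hnj δ hδ hδM
    simp only [W.gradient_logKappa]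
    obtain ⟨s₀, hs₀⟩ := FiniteRangeWalk.exists_forall_inner_sub_logKappa_le hd hδM
    have hmean₀ := FiniteRangeWalk.tiltMean_eq_of_forall_le hs₀
    refine ⟨⟨s₀, hmean₀, fun s hs => hW.tiltMean_injective (hs.trans hmean₀.symm)⟩, ?_, ?_⟩
    · have hgreat := hW.isGreatest_of_tiltMean_eq hd hδM hmean₀
      rwa [FiniteRangeWalk.phi, hgreat.csSup_eq]
    · intro s hs
      have hgreat := hW.isGreatest_of_tiltMean_eq hd hδM hs
      have hphi : W.phi δ = inner ℝ s δ - W.logKappa s := hgreat.csSup_eq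
      have hD := FiniteRangeWalk.infDist_frontier_pos hd hδM
      have hw := htilt s (hs ▸ hδM)
      rw [hs] at hw
      set D := Metric.infDist δ (frontier W.M)
      obtain ⟨hdet, hlim⟩ := hlim s (c * D ^ K) (by positivity) hw
      have hE := hlim j n x hn hnj hx (hs.trans hδ)
      refine ⟨hdet, (2 * Real.pi * n) ^ ((d : ℝ) / 2) * (W.B s).det ^ ((1 : ℝ) / 2)
        * W.tiltedStep s n x - W.period, ?_, hE.trans (le_of_eq ?_)⟩
      · have hn0 : (0 : ℝ) < n := by exact_mod_cast hn
        rw [add_sub_cancel, FiniteRangeWalk.tiltedStep_eq hn hδ, ← hphi, neg_div, neg_div,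
          Real.rpow_neg (by positivity), Real.rpow_neg hdet.le, neg_mul, Real.exp_neg]
        have h1 : (2 * Real.pi * n) ^ ((d : ℝ) / 2) ≠ 0 := by positivity
        have h2 : (W.B s).det ^ ((1 : ℝ) / 2) ≠ 0 := by positivity
        have h3 := (Real.exp_pos (n * W.phi δ)).ne'
        field_simp
      · rw [mul_inv, Real.mul_rpow (by positivity) (by positivity), ← Real.rpow_neg hD.le,
          ← Real.rpow_mul hD.le]
        have : -K * α = -2 * (K * α / 2) := by ring
        rw [this]; ring
  · intro hnj
    by_contra hne
    exact hnj (hW.modEq_of_mem_aperiodicClass hx ((W.step_nonneg n x).lt_of_ne' hne))
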